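/- Fix integers $m\ge 1$ and $K\ge 1$, a norm $\|\cdot\|$ on $\mathbb{R}^m$ (for instance the Euclidean one), let $c_m$ be the volume of its unit ball, and let $S=[0,1)^m$ carry the torus metric derived from this norm. Divide $S$ into the $K^m$ equal cubes (regions) $\prod_{i}[j_i/K,(j_i+1)/K)$, $0\le j_i<K$, and give the region $\mathcal R_\ell$ a density $\rho_\ell\ge 0$, where $\sum_\ell \rho_\ell K^{-m}=1$. Let $p\in(0,1)$ and $A_1,A_2>0$ satisfy $pA_1\max_\ell\rho_\ell<1$. The inhomogeneous SPA model generates directed graphs $G_0,G_1,G_2,\dots$ as follows. $G_0$ is empty. At each time $t\ge 1$ a node $v_t\in S$ is added, its position being independent of the past with density $\rho_\ell$ on $\mathcal R_\ell$; then, independently for each node $u$ of $G_{t-1}$ with $v_t\in S(u,t-1)$, a link $(v_t,u)$ is created with probability $p$. Here $\deg^-(u,t)$ is the in-degree of $u$ in $G_t$, and $S(u,t)$ is the ball in the torus centred at $u$ of volume $(A_1\deg^-(u,t)+A_2)/t$ (all of $S$ if this number is at least $1$). Write $\rho(v)$ for the density of the region $\mathcal R(v)$ containing $v$, $\delta(v)$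 for the distance from $v$ to the boundary of the cube $\mathcal R(v)$, and $r(v,t)=\left(\frac{A_1\deg^-(v,t)+A_2}{c_m t}\right)^{1/m}$. **Theorem 1.** Let $\omega=\omega(n)$ be any function tending to infinity with $n$, and let $\varepsilon>0$. Then, for all the parameters above, there is a sequence $\eta(n)\to 0$ such that, with probability $1-o(n^{-1})$ as $n\to\infty$, the following holds. For every node $v\in\{v_1,\dots,v_n\}$ whose in-degree $k=\deg^-(v,n)$ satisfies $k\ge\omega^2\log n$ and for which $$\delta(v)\ \ge\ (1+\varepsilon)\left(\frac{A_1k+A_2}{c_m n}\right)^{1/m}=(1+\varepsilon)\,r(v,n),$$ and for every integer $t$ with $\max\{t_v,T_v\}\le t\le n$, where $$T_v=n\left(\frac{\omega\log n}{k}\right)^{\frac1{p\rho(v)A_1}},\qquad t_v=(1+\varepsilon)\left(\frac{A_1k}{\delta(v)^m\,c_m\,n^{p\rho(v)A_1}}\right)^{\frac1{1-p\rho(v)A_1}},$$ we have $$\left|\deg^-(v,t)-k\left(\frac tn\right)^{p\rho(v)A_1}\right|\ \le\ \eta(n)\,k\left(\frac tn\right)^{p\rho(v)A_1},$$ that is,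 $\deg^-(v,t)=(1+o(1))\,k\,(t/n)^{p\rho(v)A_1}$, uniformly in $v$ and $t$. -/

import Mathlib

open MeasureTheory Filter Topology

noncomputable section

/-- Parameters of the inhomogeneous spatial preferential attachment (SPA) model in dimension `m`:
a norm `N` on `ℝ^m` (the Euclidean one, or any other) inducing the torus metric on `[0,1)^m`,
a subdivision of the unit cube into `K ^ m` equal cubes with densities `ρ j`,
the link probability `p`, and the constants `A₁`, `A₂` of the spheres of influence. -/
structure SPAModel (m : ℕ) where
  m_pos : 0 < m
  /-- the norm on `ℝ^m` -/
  N : Seminorm ℝ (Fin m → ℝ)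
  N_definite : ∀ x, N x = 0 → x = 0
  /-- number of subdivisions of each side of the unit cube -/
  K : ℕ
  K_pos : 0 < K
  /-- density of the region with index `j` -/
  ρ : (Fin m → Fin K) → ℝ
  ρ_nonneg : ∀ j, 0 ≤ ρ j
  /-- the locally constant density integrates to one -/
  ρ_total : ∑ j, ρ j * ((K : ℝ) ^ m)⁻¹ = 1
  p : ℝ
  p_pos : 0 < p
  p_lt_one : p < 1
  A₁ : ℝ
  A₁_pos : 0 < A₁
  A₂ : ℝ
  A₂_pos : 0 < A₂
  subcritical : ∀ j, p * A₁ * ρ j < 1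

namespace SPAModel

variable {m : ℕ} (M : SPAModel m)

/-! ### The space and its regions -/

/-- The space `S = [0,1)^m`. -/
def cube (m : ℕ) : Set (Fin m → ℝ) := Set.univ.pi fun _ => Set.Ico 0 1

/-- The region `∏ i, [j i / K, (j i + 1) / K)`. -/
def region (j : Fin m → Fin M.K) : Set (Fin m → ℝ) :=
  Set.univ.pi fun i => Set.Ico (((j i : ℕ) : ℝ) / M.K) ((((j i : ℕ) : ℝ) + 1) / M.K)

/-- The torus metric derived from the norm `N`. -/
def torusDist (x y : Fin m → ℝ) : ℝ := ⨅ z : Fin m → ℤ, M.N (x - y + fun i => (z i : ℝ))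

/-- The volume `c_m` of the unit ball of the norm `N` in `ℝ^m`. -/
def unitBallVolume : ℝ := volume.real {x : Fin m → ℝ | M.N x ≤ 1}

/-- The distance from `x` to the boundary of the region with index `j` (for a point `x` of the
region, the distance in `ℝ^m` and the distance in the torus agree). -/
def boundaryDist (j : Fin m → Fin M.K) (x : Fin m → ℝ) : ℝ :=
  sInf ((fun y => M.N (x - y)) '' frontier (M.region j))

/-! ### Spheres of influence -/

/-- The ball with centre `x` and radius `r` in the torus. -/
def torusBall (x : Fin m → ℝ) (r : ℝ) : Set (Fin m → ℝ) := {y ∈ cube m | M.torusDist x y ≤ r}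

/-- The radius at which a ball of the torus with centre `x` reaches the volume `V`. -/
def ballRadius (x : Fin m → ℝ) (V : ℝ) : ℝ :=
  sInf {r : ℝ | 0 ≤ r ∧ V ≤ volume.real (M.torusBall x r)}

open Classical in
/-- The ball with centre `x` and volume `V` in the torus; the whole space if `1 ≤ V`. -/
def ballOfVolume (x : Fin m → ℝ) (V : ℝ) : Set (Fin m → ℝ) :=
  if 1 ≤ V then cube m else M.torusBall x (M.ballRadius x V)

/-- The sphere of influence, at time `t`, of a node at `x` with in-degree `d`. -/
def sphere (x : Fin m → ℝ) (d t : ℕ) : Set (Fin m → ℝ) :=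
  M.ballOfVolume x ((M.A₁ * d + M.A₂) / t)

/-- The radius `((A₁ d + A₂) / (c_m t)) ^ (1 / m)` of the sphere of influence at time `t` of a
node with in-degree `d`. -/
def radius (d t : ℕ) : ℝ := ((M.A₁ * d + M.A₂) / (M.unitBallVolume * t)) ^ (1 / (m : ℝ))

/-! ### The probability space -/

/-- The law of the position of a node: density `ρ j` on the region with index `j`. -/
def positionLaw : Measure (Fin m → ℝ) :=
  ∑ j, ENNReal.ofReal (M.ρ j) • volume.restrict (M.region j)

/-- The law of a coin that shows `true` with probability `p`. -/
def coinLaw : Measure Bool :=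
  ProbabilityTheory.bernoulliMeasure true false ⟨M.p, M.p_pos.le, M.p_lt_one.le⟩

/-- An outcome: for every time `t`, the position of the node `v_t` and, for every `s`, the coin
that decides whether `v_t` links to `v_s` if it falls in the sphere of influence of `v_s`
(the entries at time `0` are not used). -/
abbrev Outcome (m : ℕ) : Type := ℕ → (Fin m → ℝ) × (ℕ → Bool)

/-- All positions and all coins are independent. -/
def prob : Measure (Outcome m) :=
  Measure.infinitePi fun _ => M.positionLaw.prod (Measure.infinitePi fun _ => M.coinLaw)

theorem volume_region (j : Fin m → Fin M.K) :
    volume (M.region j) = ENNReal.ofReal (((M.K : ℝ) ^ m)⁻¹) := by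
  have hK : (0 : ℝ) < M.K := by exact_mod_cast M.K_pos
  have h : ∀ i : Fin m, (((j i : ℕ) : ℝ) + 1) / M.K - ((j i : ℕ) : ℝ) / M.K = (M.K : ℝ)⁻¹ := by
    intro i
    field_simp
    ring
  rw [region, Real.volume_pi_Ico]
  simp only [h, Finset.prod_const, Finset.card_univ, Fintype.card_fin]
  rw [← ENNReal.ofReal_pow (by positivity), inv_pow]

instance : IsProbabilityMeasure M.positionLaw := by
  constructor
  have h : ∀ j, ENNReal.ofReal (M.ρ j) * ENNReal.ofReal (((M.K : ℝ) ^ m)⁻¹)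
      = ENNReal.ofReal (M.ρ j * ((M.K : ℝ) ^ m)⁻¹) :=
    fun j => (ENNReal.ofReal_mul (M.ρ_nonneg j)).symm
  simp only [positionLaw, Measure.coe_finsetSum, Finset.sum_apply, Measure.smul_apply,
    Measure.restrict_apply_univ, volume_region, smul_eq_mul, h]
  rw [← ENNReal.ofReal_sum_of_nonneg, M.ρ_total, ENNReal.ofReal_one]
  intro j _
  have := M.ρ_nonneg j
  positivity

instance : IsProbabilityMeasure M.coinLaw := by
  unfold coinLaw
  infer_instance

instance : IsProbabilityMeasure M.prob := by
  unfold prob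
  infer_instance

/-! ### The graph process -/

/-- The position of the node `v_t`. -/
def pos (ξ : Outcome m) (t : ℕ) : Fin m → ℝ := (ξ t).1

/-- The coin for the possible link from `v_t` to `v_s`. -/
def coin (ξ : Outcome m) (t s : ℕ) : Bool := (ξ t).2 s

/-- In-degree of the node `s` in the directed graph with edge set `E`. -/
def inDegree (E : Finset (ℕ × ℕ)) (s : ℕ) : ℕ := (E.filter fun e => e.2 = s).card

open Classical in
/-- The edge set of `G_t`, whose nodes are `v_1, …, v_t`; the pair `(u, s)` is a link from `v_u`
to `v_s`. At time `t + 1` the new node links to each node `v_s` of `G_t` whose sphere of influence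
at time `t` contains it and whose coin shows `true`. -/
def edges (ξ : Outcome m) : ℕ → Finset (ℕ × ℕ)
  | 0 => ∅
  | t + 1 => edges ξ t ∪
      ((Finset.Icc 1 t).filter fun s =>
        pos ξ (t + 1) ∈ M.sphere (pos ξ s) (inDegree (edges ξ t) s) t ∧
          coin ξ (t + 1) s = true).image fun s => (t + 1, s)

/-- The in-degree of the node `v_s` at time `t`. -/
def deg (ξ : Outcome m) (s t : ℕ) : ℕ := inDegree (M.edges ξ t) s

/-! ### The times after which the degree is predictable -/

/-- `T_v = n (ω log n / k) ^ (1 / (p ρ A₁))`, where `w` is the value of `ω` at `n`. -/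
def timeT (j : Fin m → Fin M.K) (w : ℝ) (n k : ℕ) : ℝ :=
  n * (w * Real.log n / k) ^ (1 / (M.p * M.ρ j * M.A₁))

/-- `t_v = (1 + ε) (A₁ k / (δ ^ m c_m n ^ (p ρ A₁))) ^ (1 / (1 - p ρ A₁))`. -/
def timet (j : Fin m → Fin M.K) (ε δ : ℝ) (n k : ℕ) : ℝ :=
  (1 + ε) * (M.A₁ * k / (δ ^ m * M.unitBallVolume * (n : ℝ) ^ (M.p * M.ρ j * M.A₁))) ^
    (1 / (1 - M.p * M.ρ j * M.A₁))

/-- The event that at time `n`, for every node `v = v_s` (lying in the region with index `j`, at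
distance `δ` from its boundary) with final in-degree `k ≥ w ^ 2 log n` and `δ ≥ (1 + ε) r(v, n)`,
and for all times `t` with `max {t_v, T_v} ≤ t ≤ n`, the in-degree of `v` at time `t` is
`k (t / n) ^ (p ρ A₁)` up to a relative error of at most `η`. -/
def DegreesPredicted (ξ : Outcome m) (n : ℕ) (w ε η : ℝ) : Prop :=
  ∀ s : ℕ, 1 ≤ s → s ≤ n → ∀ j : Fin m → Fin M.K, pos ξ s ∈ M.region j →
    ∀ k : ℕ, k = M.deg ξ s n → ∀ δ : ℝ, δ = M.boundaryDist j (pos ξ s) →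
    w ^ 2 * Real.log n ≤ k → (1 + ε) * M.radius k n ≤ δ →
    ∀ t : ℕ, max (M.timet j ε δ n k) (M.timeT j w n k) ≤ t → t ≤ n →
      |(M.deg ξ s t : ℝ) - k * ((t : ℝ) / n) ^ (M.p * M.ρ j * M.A₁)| ≤
        η * (k * ((t : ℝ) / n) ^ (M.p * M.ρ j * M.A₁))

end SPAModel

end

noncomputable section

namespace SPAModel

variable {m : ℕ} (M : SPAModel m)

/-! ### Balls of the norm -/

/-! Put `B = A₂ / A₁`, `α = p ρ A₁` and `Y_u = deg u + B`. While the sphere of influence of a node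
stays inside its region, the conditional probability of a new link is exactly `α Y_u / u`. Hence
`Y_u / growth α t u` is a martingale, and `growth α t n` is `(n / t) ^ α` up to a factor `1 + O(1 /
t)`.

Concentration comes from exponential supermartingales compensated by the true conditional link
probability (`linkProb`), which are valid whether or not the sphere fits in the region
(`lintegral_exp_expo_le_one`). With weights `±θ / growth α t (u + 1)`, `θ = ω ^ (-1/2)`, a Markov
bound at level `4 log n` and a union bound over the node, the starting time, the region and the sign
give one good event, `ExposBounded`, that fails with probability `O(n⁻²)`
(`prob_not_exposBounded_le`). There is no conditioning on the final degree `k`: the rest is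
deterministic on the good event.

There the time runs backwards from `n` (`abs_deg_sub_div_growth_le`). If the estimate holds at all
later times, then `t ≥ t_v` keeps the spheres from time `t` on inside the region, so the drift is
linear, and the quadratic variation is bounded by the extrapolated value `D = Y_n / growth α t n`.
The supermartingale bounds for both signs yield `|Y_t - D| ≤ 2 θ D + 4 log n / θ`
(`abs_sub_div_growth_le`). Since `t ≥ T_v` gives `D ≥ ω log n / 2`, the right side is at most `10 θ
D`. Each time is compared directly with `n`, so errors do not accumulate along the induction. -/

theorem continuous_N : Continuous M.N :=
  (M.N.convexOn.locallyLipschitz).continuous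

/-- The closed ball of the norm `N`. -/
def normBall (x : Fin m → ℝ) (r : ℝ) : Set (Fin m → ℝ) := {y | M.N (x - y) ≤ r}

/-- By definiteness and compactness `N` has a positive minimum on the unit sphere of the sup norm.
This makes the unit ball of `N` bounded, hence of finite volume. -/
theorem exists_norm_le_N : ∃ C > 0, ∀ x, ‖x‖ ≤ C * M.N x := by
  rcases (Metric.sphere (0 : Fin m → ℝ) 1).eq_empty_or_nonempty with h | h
  · refine ⟨1, one_pos, fun x => ?_⟩
    by_cases hx : x = 0
    · simp [hx]
    · exfalso
      have : ‖x‖⁻¹ • x ∈ Metric.sphere (0 : Fin m → ℝ) 1 := by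
        simp [norm_smul, hx]
      simp [h] at this
  · obtain ⟨z, hz, hmin⟩ := (isCompact_sphere (0 : Fin m → ℝ) 1).exists_isMinOn h
      M.continuous_N.continuousOn
    have hz0 : z ≠ 0 := by
      rintro rfl
      simp at hz
    have hpos : 0 < M.N z := lt_of_le_of_ne (apply_nonneg _ _) fun h => hz0 (M.N_definite z h.symm)
    refine ⟨(M.N z)⁻¹, inv_pos.2 hpos, fun x => ?_⟩
    by_cases hx : x = 0
    · simp [hx]
    have hx' : 0 < ‖x‖ := norm_pos_iff.2 hx
    have h1 : ‖x‖⁻¹ • x ∈ Metric.sphere (0 : Fin m → ℝ) 1 := by simp [norm_smul, hx]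
    have h2 : M.N z ≤ M.N (‖x‖⁻¹ • x) := hmin h1
    rw [map_smul_eq_mul, norm_inv, norm_norm] at h2
    rw [inv_mul_eq_div, le_div_iff₀ hpos]
    calc ‖x‖ * M.N z ≤ ‖x‖ * (‖x‖⁻¹ * M.N x) := by gcongr
      _ = M.N x := by field_simp

theorem unitBallVolume_pos : 0 < M.unitBallVolume := by
  obtain ⟨C, hC, h⟩ := M.exists_norm_le_N
  have hfin : volume {x : Fin m → ℝ | M.N x ≤ 1} ≠ ⊤ := by
    refine ((Metric.isBounded_closedBall (x := (0 : Fin m → ℝ)) (r := C)).subset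
      ?_).measure_lt_top.ne
    intro x hx
    have hx : M.N x ≤ 1 := hx
    simp only [mem_closedBall_zero_iff]
    calc ‖x‖ ≤ C * M.N x := h x
      _ ≤ C * 1 := by gcongr
      _ = C := mul_one C
  have hpos : volume {x : Fin m → ℝ | M.N x ≤ 1} ≠ 0 := by
    have ho : IsOpen {x : Fin m → ℝ | M.N x < 1} := isOpen_lt M.continuous_N continuous_const
    have : 0 < volume {x : Fin m → ℝ | M.N x < 1} := ho.measure_pos _ ⟨0, by simp⟩
    exact (this.trans_le (measure_mono fun x (hx : M.N x < 1) => hx.le)).ne'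
  exact ENNReal.toReal_pos hpos hfin

open scoped Pointwise in
theorem volume_normBall (x : Fin m → ℝ) {r : ℝ} (hr : 0 ≤ r) :
    volume.real (M.normBall x r) = M.unitBallVolume * r ^ m := by
  rcases hr.eq_or_lt with rfl | hr
  · have h0 : M.normBall x 0 = {x} := by
      ext y
      simp only [normBall, Set.mem_ofPred_eq, Set.mem_singleton_iff]
      constructor
      · intro h
        exact (sub_eq_zero.1 (M.N_definite _ (le_antisymm h (apply_nonneg _ _)))).symm
      · rintro rfl
        simp
    have : Nonempty (Fin m) := ⟨⟨0, M.m_pos⟩⟩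
    rw [h0, zero_pow M.m_pos.ne', mul_zero, measureReal_def, measure_singleton, ENNReal.toReal_zero]
  · have h1 : M.normBall x r = (fun y => x - y) ⁻¹' (r • {z : Fin m → ℝ | M.N z ≤ 1}) := by
      ext y
      simp only [normBall, Set.mem_ofPred_eq, Set.mem_preimage,
        Set.mem_smul_set_iff_inv_smul_mem₀ hr.ne', map_smul_eq_mul, norm_inv,
        Real.norm_of_nonneg hr.le]
      rw [inv_mul_le_iff₀ hr, mul_one]
    have hmeas : MeasurableSet (r • {z : Fin m → ℝ | M.N z ≤ 1}) :=
      (IsClosed.smul_of_ne_zero (isClosed_le M.continuous_N continuous_const) hr.ne').measurableSet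
    rw [h1, measureReal_def,
      (volume.measurePreserving_sub_left x).measure_preimage hmeas.nullMeasurableSet,
      Measure.addHaar_smul, ENNReal.toReal_mul, ENNReal.toReal_ofReal (abs_nonneg _),
      Module.finrank_fin_fun, abs_of_pos (by positivity), mul_comm]
    rfl

/-! ### Balls inside a region -/

theorem measurableSet_region (j : Fin m → Fin M.K) : MeasurableSet (M.region j) :=
  MeasurableSet.univ_pi fun _ => measurableSet_Ico

theorem measurableSet_cube : MeasurableSet (cube m) :=
  MeasurableSet.univ_pi fun _ => measurableSet_Ico

theorem region_subset_cube (j : Fin m → Fin M.K) : M.region j ⊆ cube m := by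
  intro y hy i hi
  have hK : (0 : ℝ) < M.K := by exact_mod_cast M.K_pos
  obtain ⟨h1, h2⟩ := hy i hi
  have h3 : (((j i : ℕ) : ℝ) + 1) / M.K ≤ 1 := by
    rw [div_le_one hK]
    exact_mod_cast (j i).2
  exact ⟨(by positivity : (0 : ℝ) ≤ ((j i : ℕ) : ℝ) / M.K).trans h1, h2.trans_le h3⟩

theorem eq_of_mem_region {i j : Fin m → Fin M.K} {y : Fin m → ℝ} (hi : y ∈ M.region i)
    (hj : y ∈ M.region j) : i = j := by
  have hK : (0 : ℝ) < M.K := by exact_mod_cast M.K_pos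
  have key : ∀ {i j : Fin m → Fin M.K}, y ∈ M.region i → y ∈ M.region j → ∀ l, i l ≤ j l := by
    intro i j hi hj l
    have h := (hi l trivial).1.trans_lt (hj l trivial).2
    rw [div_lt_div_iff_of_pos_right hK] at h
    have h : ((i l : ℕ)) < (j l : ℕ) + 1 := by exact_mod_cast h
    exact Nat.lt_succ_iff.1 h
  funext l
  exact le_antisymm (key hi hj l) (key hj hi l)

theorem positionLaw_of_subset_region {j : Fin m → Fin M.K} {B : Set (Fin m → ℝ)}
    (hB : B ⊆ M.region j) : M.positionLaw.real B = M.ρ j * volume.real B := by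
  have h : ∀ i, volume.restrict (M.region i) B = if i = j then volume B else 0 := by
    intro i
    rw [Measure.restrict_apply' (M.measurableSet_region i)]
    split_ifs with hij
    · subst hij
      rw [Set.inter_eq_left.2 hB]
    · have : B ∩ M.region i = ∅ := by
        ext y
        simp only [Set.mem_inter_iff, Set.mem_empty_iff_false, iff_false, not_and]
        exact fun hy hi => hij (M.eq_of_mem_region hi (hB hy))
      rw [this, measure_empty]
  simp only [measureReal_def, positionLaw, Measure.coe_finsetSum, Finset.sum_apply,
    Measure.smul_apply, h, smul_eq_mul, mul_ite, mul_zero, Finset.sum_ite_eq', Finset.mem_univ,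
    if_true, ENNReal.toReal_mul, ENNReal.toReal_ofReal (M.ρ_nonneg j)]

theorem boundaryDist_le {j : Fin m → Fin M.K} {x y : Fin m → ℝ} (hy : y ∈ frontier (M.region j)) :
    M.boundaryDist j x ≤ M.N (x - y) :=
  csInf_le ⟨0, by rintro _ ⟨z, -, rfl⟩; exact apply_nonneg _ _⟩ ⟨y, hy, rfl⟩

/-- The segment from `x` to `y` is too short to meet the frontier, and it is connected, so it stays
in the interior. -/
theorem mem_region_of_N_sub_lt {j : Fin m → Fin M.K} {x y : Fin m → ℝ} (hx : x ∈ M.region j)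
    (h : M.N (x - y) < M.boundaryDist j x) : y ∈ M.region j := by
  have hseg : ∀ z ∈ segment ℝ x y, z ∉ frontier (M.region j) := by
    intro z hz hf
    obtain ⟨θ, ⟨h0, h1⟩, rfl⟩ := (segment_eq_image' ℝ x y ▸ hz :)
    have h2 := M.boundaryDist_le (x := x) hf
    have h3 : x - (x + θ • (y - x)) = θ • (x - y) := by
      rw [smul_sub, smul_sub]; abel
    rw [h3, map_smul_eq_mul, Real.norm_of_nonneg h0] at h2
    have : θ * M.N (x - y) ≤ 1 * M.N (x - y) := by
      gcongr
    linarith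
  have hcover : segment ℝ x y ⊆ interior (M.region j) ∪ (closure (M.region j))ᶜ := by
    intro z hz
    have := hseg z hz
    rw [frontier, Set.mem_sdiff, not_and, not_not] at this
    by_cases hc : z ∈ closure (M.region j)
    · exact Or.inl (this hc)
    · exact Or.inr hc
  have hxi : x ∈ interior (M.region j) :=
    (hcover (left_mem_segment ℝ x y)).resolve_right fun h => h (subset_closure hx)
  have := (convex_segment (𝕜 := ℝ) x y).isPreconnected.subset_left_of_subset_union
    isOpen_interior isClosed_closure.isOpen_compl
    (Set.disjoint_compl_right_iff_subset.2 (interior_subset.trans subset_closure)) hcover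
    ⟨x, left_mem_segment ℝ x y, hxi⟩
  exact interior_subset (this (right_mem_segment ℝ x y))

theorem eq_of_mem_cube_of_sub_mem_cube {y : Fin m → ℝ} {z : Fin m → ℤ} (hy : y ∈ cube m)
    (hz : (y - fun i => (z i : ℝ)) ∈ cube m) : z = 0 := by
  funext i
  obtain ⟨h1, h2⟩ := hy i trivial
  obtain ⟨h3, h4⟩ := hz i trivial
  simp only [Pi.sub_apply] at h3 h4
  have h5 : (z i : ℝ) < 1 := by linarith
  have h6 : (-1 : ℝ) < z i := by linarith
  have h5 : z i < 1 := by exact_mod_cast h5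
  have h6 : -1 < z i := by exact_mod_cast h6
  simp only [Pi.zero_apply]
  omega

theorem torusDist_le_N (x y : Fin m → ℝ) : M.torusDist x y ≤ M.N (x - y) := by
  refine (ciInf_le ⟨0, ?_⟩ (0 : Fin m → ℤ)).trans_eq ?_
  · rintro _ ⟨z, rfl⟩
    exact apply_nonneg _ _
  · simp only [Pi.zero_apply, Int.cast_zero]
    congr 1
    ext i
    simp

/-- An integer translate of `y` this close to `x` lies in the region, hence in the unit cube; as `y`
is in the cube too, the translation is zero. Thus there is no wrap-around. -/
theorem N_sub_lt_of_torusDist_lt {j : Fin m → Fin M.K} {x y : Fin m → ℝ} {r : ℝ}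
    (hx : x ∈ M.region j) (hr : r ≤ M.boundaryDist j x) (hy : y ∈ cube m)
    (h : M.torusDist x y < r) : M.N (x - y) < r := by
  obtain ⟨z, hz⟩ := exists_lt_of_ciInf_lt h
  have he : (x - y + fun i => (z i : ℝ)) = x - (y - fun i => (z i : ℝ)) := by abel
  rw [he] at hz
  have h1 := M.region_subset_cube j (M.mem_region_of_N_sub_lt hx (hz.trans_le hr))
  have h2 := eq_of_mem_cube_of_sub_mem_cube hy h1
  subst h2
  have h3 : (y - fun i => (((0 : Fin m → ℤ) i : ℤ) : ℝ)) = y := by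
    ext i
    simp
  rwa [h3] at hz

theorem normBall_subset_region {j : Fin m → Fin M.K} {x : Fin m → ℝ} {r : ℝ}
    (hx : x ∈ M.region j) (hr : r < M.boundaryDist j x) : M.normBall x r ⊆ M.region j :=
  fun _ hy => M.mem_region_of_N_sub_lt hx (lt_of_le_of_lt hy hr)

theorem torusBall_eq_normBall {j : Fin m → Fin M.K} {x : Fin m → ℝ} {r : ℝ}
    (hx : x ∈ M.region j) (hr : r < M.boundaryDist j x) : M.torusBall x r = M.normBall x r := by
  ext y
  constructor
  · rintro ⟨hy, hd⟩
    -- Passing to every `r' > r` avoids having to show that the infimum over translates is attained.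
    refine le_of_forall_gt_imp_ge_of_dense (a₁ := M.N (x - y)) (a₂ := r) fun r' hr' => ?_
    have := M.N_sub_lt_of_torusDist_lt (r := min r' (M.boundaryDist j x)) hx (min_le_right _ _) hy
      (hd.trans_lt (lt_min hr' hr))
    exact this.le.trans (min_le_left _ _)
  · intro hy
    exact ⟨M.region_subset_cube j (M.normBall_subset_region hx hr hy),
      (M.torusDist_le_N x y).trans hy⟩

theorem volume_cube : volume (cube m) = 1 := by
  simp [cube, Real.volume_pi_Ico]

/-- A ball of volume `V` whose radius is less than the distance to the boundary of the region is
a ball of the norm `N`. -/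
theorem ballOfVolume_eq_normBall {j : Fin m → Fin M.K} {x : Fin m → ℝ} {r : ℝ}
    (hx : x ∈ M.region j) (hr0 : 0 ≤ r) (hr : r < M.boundaryDist j x) :
    M.ballOfVolume x (M.unitBallVolume * r ^ m) = M.normBall x r := by
  have hc := M.unitBallVolume_pos
  have hvol : ∀ r', 0 ≤ r' → r' < M.boundaryDist j x →
      volume.real (M.torusBall x r') = M.unitBallVolume * r' ^ m := by
    intro r' h0 h1
    rw [M.torusBall_eq_normBall hx h1, M.volume_normBall x h0]
  -- A slightly larger ball still fits in the cube, so the volume is strictly below 1 and the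
  -- whole-space case of `ballOfVolume` does not occur.
  have hlt : ¬ 1 ≤ M.unitBallVolume * r ^ m := by
    obtain ⟨r', h1, h2⟩ := exists_between hr
    have h3 : M.unitBallVolume * r ^ m < M.unitBallVolume * r' ^ m :=
      mul_lt_mul_of_pos_left (pow_lt_pow_left₀ h1 hr0 M.m_pos.ne') hc
    rw [← M.volume_normBall x (hr0.trans h1.le)] at h3
    have h4 : volume.real (M.normBall x r') ≤ volume.real (cube m) :=
      measureReal_mono ((M.normBall_subset_region hx h2).trans (M.region_subset_cube j))
        (by simp [volume_cube])
    rw [measureReal_def, measureReal_def, volume_cube, ENNReal.toReal_one] at h4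
    rw [measureReal_def] at h3
    linarith
  have hrad : M.ballRadius x (M.unitBallVolume * r ^ m) = r := by
    refine IsLeast.csInf_eq ⟨⟨hr0, (hvol r hr0 hr).ge⟩, ?_⟩
    rintro r' ⟨h0, h1⟩
    by_contra! hlt'
    rw [hvol r' h0 (hlt'.trans hr)] at h1
    have := mul_lt_mul_of_pos_left (pow_lt_pow_left₀ hlt' h0 M.m_pos.ne') hc
    linarith
  rw [ballOfVolume, if_neg hlt, hrad, M.torusBall_eq_normBall hx hr]

theorem positionLaw_ballOfVolume {j : Fin m → Fin M.K} {x : Fin m → ℝ} {V : ℝ}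
    (hx : x ∈ M.region j) (hV : 0 ≤ V) (hδ : 0 ≤ M.boundaryDist j x)
    (h : V < M.unitBallVolume * M.boundaryDist j x ^ m) :
    M.positionLaw.real (M.ballOfVolume x V) = M.ρ j * V := by
  have hc := M.unitBallVolume_pos
  have hVc : 0 ≤ V / M.unitBallVolume := by positivity
  have hrm : ((V / M.unitBallVolume) ^ ((m : ℝ)⁻¹)) ^ m = V / M.unitBallVolume :=
    Real.rpow_inv_natCast_pow hVc M.m_pos.ne'
  have hr : (V / M.unitBallVolume) ^ ((m : ℝ)⁻¹) < M.boundaryDist j x := by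
    refine lt_of_pow_lt_pow_left₀ m hδ ?_
    rw [hrm, div_lt_iff₀ hc]
    linarith
  have hr0 : 0 ≤ (V / M.unitBallVolume) ^ ((m : ℝ)⁻¹) := by positivity
  have hVe : V = M.unitBallVolume * ((V / M.unitBallVolume) ^ ((m : ℝ)⁻¹)) ^ m := by
    rw [hrm]; field_simp
  have hb := M.ballOfVolume_eq_normBall hx hr0 hr
  rw [← hVe] at hb
  rw [hb, M.positionLaw_of_subset_region (M.normBall_subset_region hx hr),
    M.volume_normBall x hr0, ← hVe]

/-! ### Measurability of the spheres of influence -/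

theorem measurable_torusDist :
    Measurable fun q : (Fin m → ℝ) × (Fin m → ℝ) => M.torusDist q.1 q.2 := by
  refine Measurable.iInf fun z => (M.continuous_N.comp ?_).measurable
  fun_prop

theorem measurableSet_torusBall_graph {f : (Fin m → ℝ) → ℝ} (hf : Measurable f) :
    MeasurableSet {q : (Fin m → ℝ) × (Fin m → ℝ) | q.2 ∈ M.torusBall q.1 (f q.1)} :=
  (measurable_snd measurableSet_cube).inter
    (measurableSet_le M.measurable_torusDist (hf.comp measurable_fst))

theorem measurable_volume_torusBall (r : ℝ) :
    Measurable fun x => volume.real (M.torusBall x r) :=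
  (measurable_measure_prodMk_left (ν := volume)
    (M.measurableSet_torusBall_graph (measurable_const (a := r)))).ennreal_toReal

theorem volume_torusBall_mono (x : Fin m → ℝ) {r r' : ℝ} (h : r ≤ r') :
    volume.real (M.torusBall x r) ≤ volume.real (M.torusBall x r') := by
  refine measureReal_mono (fun y hy => ⟨hy.1, hy.2.trans h⟩) (ne_top_of_le_ne_top ?_
    (measure_mono (fun y hy => hy.1 : M.torusBall x r' ⊆ cube m)))
  simp [volume_cube]

/-- The volume of a ball is monotone in its radius, so the infimum can be tested on rational radii,
which leaves countable unions and intersections. -/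
theorem measurable_ballRadius (V : ℝ) : Measurable fun x => M.ballRadius x V := by
  set S : (Fin m → ℝ) → Set ℝ := fun x => {r : ℝ | 0 ≤ r ∧ V ≤ volume.real (M.torusBall x r)}
    with hS
  have hrat : ∀ x r c, r ∈ S x → r < c → ∃ q : ℚ, (q : ℝ) < c ∧ (q : ℝ) ∈ S x := by
    intro x r c hr hc
    obtain ⟨q, h1, h2⟩ := exists_rat_btwn hc
    exact ⟨q, h2, hr.1.trans h1.le, hr.2.trans (M.volume_torusBall_mono x h1.le)⟩
  have hmeas : ∀ q : ℚ, MeasurableSet {x | (q : ℝ) ∈ S x} := by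
    intro q
    by_cases hq : (0 : ℝ) ≤ q
    · simp only [hS, Set.mem_ofPred_eq, hq, true_and]
      exact measurableSet_le measurable_const (M.measurable_volume_torusBall _)
    · simp [hS, hq]
  refine measurable_of_Iio fun c => ?_
  have : (fun x => M.ballRadius x V) ⁻¹' Set.Iio c =
      (⋃ q : ℚ, {x | (q : ℝ) ∈ S x ∧ (q : ℝ) < c}) ∪ ((⋂ q : ℚ, {x | (q : ℝ) ∈ S x}ᶜ) ∩
        {_x | 0 < c}) := by
    ext x
    simp only [Set.mem_preimage, Set.mem_Iio, Set.mem_union, Set.mem_iUnion, Set.mem_ofPred_eq,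
      Set.mem_inter_iff, Set.mem_iInter, Set.mem_compl_iff]
    have hbdd : BddBelow (S x) := ⟨0, fun r hr => hr.1⟩
    rcases (S x).eq_empty_or_nonempty with he | hne
    -- If no radius reaches the volume, `sInf ∅ = 0`; the second set of the union accounts for this
    -- value.
    · have : M.ballRadius x V = 0 := by
        change sInf (S x) = 0
        rw [he, Real.sInf_empty]
      rw [this, he]
      simp
    · have : M.ballRadius x V = sInf (S x) := rfl
      rw [this, csInf_lt_iff hbdd hne]
      constructor
      · rintro ⟨r, hr, hc⟩
        obtain ⟨q, h1, h2⟩ := hrat x r c hr hc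
        exact Or.inl ⟨q, h2, h1⟩
      · rintro (⟨q, h1, h2⟩ | ⟨h, -⟩)
        · exact ⟨q, h1, h2⟩
        · obtain ⟨r, hr⟩ := hne
          obtain ⟨q, -, h2⟩ := hrat x r (r + 1) hr (by linarith)
          exact absurd h2 (h q)
  rw [this]
  refine (MeasurableSet.iUnion fun q => ?_).union
    ((MeasurableSet.iInter fun q => (hmeas q).compl).inter (MeasurableSet.const _))
  exact (hmeas q).inter (MeasurableSet.const _)

theorem measurableSet_sphere_graph (d t : ℕ) :
    MeasurableSet {q : (Fin m → ℝ) × (Fin m → ℝ) | q.2 ∈ M.sphere q.1 d t} := by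
  unfold sphere ballOfVolume
  split_ifs
  · exact measurable_snd measurableSet_cube
  · exact M.measurableSet_torusBall_graph (M.measurable_ballRadius _)

/-! ### The evolution of one in-degree -/

/-- The node `v_(u+1)` falls in the sphere of influence of `v_s` and its coin for `v_s` shows
`true`. -/
def Links (ξ : Outcome m) (s u : ℕ) : Prop :=
  pos ξ (u + 1) ∈ M.sphere (pos ξ s) (M.deg ξ s u) u ∧ coin ξ (u + 1) s = true

theorem fst_le_of_mem_edges (ξ : Outcome m) {t : ℕ} {e : ℕ × ℕ} (he : e ∈ M.edges ξ t) :
    e.1 ≤ t := by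
  induction t with
  | zero => simp [edges] at he
  | succ t ih =>
    rw [edges, Finset.mem_union, Finset.mem_image] at he
    rcases he with he | ⟨s, -, rfl⟩
    · exact (ih he).trans t.le_succ
    · exact le_rfl

open Classical in
theorem deg_succ (ξ : Outcome m) {s : ℕ} (hs : 1 ≤ s) (u : ℕ) :
    M.deg ξ s (u + 1) = M.deg ξ s u + if s ≤ u ∧ M.Links ξ s u then 1 else 0 := by
  rw [deg, inDegree, edges, Finset.filter_union, Finset.card_union_of_disjoint]
  · congr 1
    rw [Finset.filter_image]
    rw [Finset.card_image_of_injective _ (fun a b h => (Prod.mk.inj h).2)]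
    rw [Finset.filter_filter]
    by_cases h : s ≤ u ∧ M.Links ξ s u
    · rw [if_pos h, Finset.card_eq_one]
      refine ⟨s, ?_⟩
      ext a
      simp only [Finset.mem_filter, Finset.mem_Icc, Finset.mem_singleton]
      constructor
      · exact fun h => h.2.2
      · rintro rfl
        exact ⟨⟨hs, h.1⟩, h.2, rfl⟩
    · rw [if_neg h, Finset.card_eq_zero]
      ext a
      simp only [Finset.mem_filter, Finset.mem_Icc, Finset.notMem_empty, iff_false]
      rintro ⟨h1, h2, rfl⟩
      exact h ⟨h1.2, h2⟩
  · rw [Finset.disjoint_left]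
    intro e h1 h2
    have h3 := M.fst_le_of_mem_edges ξ (Finset.mem_filter.1 h1).1
    obtain ⟨a, -, rfl⟩ := Finset.mem_image.1 (Finset.mem_filter.1 h2).1
    simp at h3

theorem deg_zero (ξ : Outcome m) (s : ℕ) : M.deg ξ s 0 = 0 := by
  simp [deg, edges, inDegree]

theorem deg_eq_zero (ξ : Outcome m) {s : ℕ} (hs : 1 ≤ s) {t : ℕ} (h : t ≤ s) :
    M.deg ξ s t = 0 := by
  induction t with
  | zero => exact M.deg_zero ξ s
  | succ t ih => rw [M.deg_succ ξ hs, ih (by omega), if_neg (by omega)]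

theorem deg_le_succ (ξ : Outcome m) {s : ℕ} (hs : 1 ≤ s) (t : ℕ) :
    M.deg ξ s t ≤ M.deg ξ s (t + 1) := by
  rw [M.deg_succ ξ hs]
  exact Nat.le_add_right _ _

/-- At most one link arrives per step, and none at time 1. Read backwards, a large degree at `t + 1`
forces `t` itself to be large. -/
theorem deg_succ_le (ξ : Outcome m) {s : ℕ} (hs : 1 ≤ s) (t : ℕ) :
    M.deg ξ s (t + 1) ≤ t := by
  induction t with
  | zero => exact (M.deg_eq_zero ξ hs (by omega)).le
  | succ t ih =>
    rw [M.deg_succ ξ hs]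
    split_ifs <;> omega

/-! ### Resampling one node -/

/-- The law of the position and the coins of one node. -/
def nodeLaw : Measure ((Fin m → ℝ) × (ℕ → Bool)) :=
  M.positionLaw.prod (Measure.infinitePi fun _ => M.coinLaw)

instance : IsProbabilityMeasure M.nodeLaw := by
  unfold nodeLaw
  infer_instance

open Classical in
theorem edges_update (ξ : Outcome m) (y : (Fin m → ℝ) × (ℕ → Bool)) {u t : ℕ} (h : t ≤ u) :
    M.edges (Function.update ξ (u + 1) y) t = M.edges ξ t := by
  induction t with
  | zero => rfl
  | succ t ih =>
    rw [edges, edges, ih (by omega)]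
    congr 2
    refine Finset.filter_congr fun s hs => ?_
    have h1 : s ≠ u + 1 := by
      have := (Finset.mem_Icc.1 hs).2
      omega
    have h2 : t + 1 ≠ u + 1 := by omega
    simp only [pos, coin, Function.update_of_ne h1, Function.update_of_ne h2]

theorem deg_update (ξ : Outcome m) (y : (Fin m → ℝ) × (ℕ → Bool)) (s : ℕ) {u t : ℕ} (h : t ≤ u) :
    M.deg (Function.update ξ (u + 1) y) s t = M.deg ξ s t := by
  rw [deg, deg, M.edges_update ξ y h]

/-- Redrawing one coordinate independently preserves a product measure, as one checks on boxes.
Integrating over the redrawn coordinate then plays the role of conditional expectation given the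
past, without a filtration. -/
theorem _root_.MeasureTheory.Measure.infinitePi_map_update {ι : Type*} [DecidableEq ι]
    {X : ι → Type*} {mX : ∀ i, MeasurableSpace (X i)} (μ : ∀ i, Measure (X i))
    [∀ i, IsProbabilityMeasure (μ i)] (i : ι) :
    ((Measure.infinitePi μ).prod (μ i)).map (fun q => Function.update q.1 i q.2)
      = Measure.infinitePi μ := by
  have hmeas : Measurable fun q : (∀ i, X i) × X i => Function.update q.1 i q.2 :=
    measurable_update'
  refine Measure.eq_infinitePi _ fun s t ht => ?_
  rw [Measure.map_apply hmeas (MeasurableSet.pi s.countable_toSet fun i _ => ht i)]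
  by_cases hi : i ∈ s
  · have : (fun q : (∀ i, X i) × X i => Function.update q.1 i q.2) ⁻¹' (↑s : Set ι).pi t
        = ((↑(s.erase i) : Set ι).pi t) ×ˢ t i := by
      ext q
      simp only [Set.mem_preimage, Set.mem_pi, Set.mem_prod, Finset.mem_coe, Finset.mem_erase]
      constructor
      · intro h
        refine ⟨fun l hl => ?_, ?_⟩
        · have := h l hl.2
          rwa [Function.update_of_ne hl.1] at this
        · have := h i hi
          rwa [Function.update_self] at this
      · rintro ⟨h1, h2⟩ l hl
        by_cases hli : l = i
        · subst hli
          rwa [Function.update_self]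
        · rw [Function.update_of_ne hli]
          exact h1 l ⟨hli, hl⟩
    rw [this, Measure.prod_prod, Measure.infinitePi_pi μ fun i _ => ht i,
      Finset.prod_erase_mul _ _ hi]
  · have : (fun q : (∀ i, X i) × X i => Function.update q.1 i q.2) ⁻¹' (↑s : Set ι).pi t
        = ((↑s : Set ι).pi t) ×ˢ Set.univ := by
      ext q
      simp only [Set.mem_preimage, Set.mem_pi, Set.mem_prod, Finset.mem_coe, Set.mem_univ, and_true]
      refine forall₂_congr fun l hl => ?_
      rw [Function.update_of_ne (fun h : l = i => hi (h ▸ hl))]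
    rw [this, Measure.prod_prod, Measure.infinitePi_pi μ fun i _ => ht i, measure_univ, mul_one]

theorem map_update_prob (i : ℕ) :
    (M.prob.prod M.nodeLaw).map (fun q => Function.update q.1 i q.2) = M.prob :=
  Measure.infinitePi_map_update (fun _ : ℕ => M.nodeLaw) i

theorem coinLaw_true : M.coinLaw {true} = ENNReal.ofReal M.p := by
  rw [coinLaw, ProbabilityTheory.bernoulliMeasure_apply_of_mem_of_notMem _
    (measurableSet_singleton _) (by simp) (by simp)]
  rw [ENNReal.ofReal]
  congr 1
  ext
  rw [Real.coe_toNNReal _ M.p_pos.le]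
  rfl

theorem nodeLaw_prod (A : Set (Fin m → ℝ)) (s : ℕ) :
    M.nodeLaw.real (A ×ˢ {b | b s = true}) = M.p * M.positionLaw.real A := by
  have h : (Measure.infinitePi fun _ : ℕ => M.coinLaw) {b | b s = true} = ENNReal.ofReal M.p := by
    have h1 := Measure.infinitePi_map_eval (fun _ : ℕ => M.coinLaw) s
    rw [← M.coinLaw_true, ← h1, Measure.map_apply (measurable_pi_apply s)
      (measurableSet_singleton _), h1]
    rfl
  rw [measureReal_def, nodeLaw, Measure.prod_prod, h, ENNReal.toReal_mul,
    ENNReal.toReal_ofReal M.p_pos.le, mul_comm]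
  rfl

/-! ### The compensated in-degree -/

/-- The conditional probability, given the past, that `v_(u+1)` links to `v_s`. -/
def linkProb (ξ : Outcome m) (s u : ℕ) : ℝ :=
  M.p * M.positionLaw.real (M.sphere (pos ξ s) (M.deg ξ s u) u)

open Classical in
/-- The indicator of `Links`. -/
def link (ξ : Outcome m) (s u : ℕ) : ℝ := if M.Links ξ s u then 1 else 0

/-- The exponent of the exponential supermartingale with weights `w`. -/
def expo (w : ℕ → ℝ) (ξ : Outcome m) (s a b : ℕ) : ℝ :=
  ∑ u ∈ Finset.Ico a b,
    (w u * (M.link ξ s u - M.linkProb ξ s u) - w u ^ 2 * M.linkProb ξ s u)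

theorem measurable_pos (t : ℕ) : Measurable fun ξ : Outcome m => pos ξ t :=
  measurable_fst.comp (measurable_pi_apply t)

theorem measurableSet_links_of_measurable_deg {s u : ℕ}
    (h : Measurable fun ξ => M.deg ξ s u) : MeasurableSet {ξ | M.Links ξ s u} := by
  have hm : Measurable fun ξ : Outcome m => coin ξ (u + 1) s :=
    (measurable_pi_apply s).comp (measurable_snd.comp (measurable_pi_apply (u + 1)))
  have hc : MeasurableSet {ξ : Outcome m | coin ξ (u + 1) s = true} :=
    hm (measurableSet_singleton true)
  have : {ξ | M.Links ξ s u} = (⋃ d : ℕ, {ξ | M.deg ξ s u = d} ∩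
      {ξ | pos ξ (u + 1) ∈ M.sphere (pos ξ s) d u}) ∩ {ξ | coin ξ (u + 1) s = true} := by
    ext ξ
    simp [Links]
  rw [this]
  refine (MeasurableSet.iUnion fun d => ?_).inter hc
  exact (h (measurableSet_singleton d)).inter
    (((measurable_pos s).prodMk (measurable_pos (u + 1))) (M.measurableSet_sphere_graph d u))

theorem measurable_deg {s : ℕ} (hs : 1 ≤ s) (t : ℕ) : Measurable fun ξ => M.deg ξ s t := by
  classical
  induction t with
  | zero => simp only [deg_zero, measurable_const]
  | succ t ih =>
    simp only [M.deg_succ _ hs]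
    exact ih.add (Measurable.ite ((MeasurableSet.const _).inter
      (M.measurableSet_links_of_measurable_deg ih)) measurable_const measurable_const)

theorem measurable_link {s : ℕ} (hs : 1 ≤ s) (u : ℕ) : Measurable fun ξ => M.link ξ s u := by
  classical
  exact Measurable.ite (M.measurableSet_links_of_measurable_deg (M.measurable_deg hs u))
    measurable_const measurable_const

theorem measurable_linkProb {s : ℕ} (hs : 1 ≤ s) (u : ℕ) :
    Measurable fun ξ => M.linkProb ξ s u := by
  have h : ∀ d, Measurable fun ξ : Outcome m =>
      M.positionLaw.real (M.sphere (pos ξ s) d u) := fun d =>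
    Measurable.comp (g := fun x => M.positionLaw.real (M.sphere x d u))
      (measurable_measure_prodMk_left (ν := M.positionLaw)
        (M.measurableSet_sphere_graph d u)).ennreal_toReal (measurable_pos s)
  have h2 : Measurable (Function.uncurry fun (ξ : Outcome m) (d : ℕ) =>
      M.positionLaw.real (M.sphere (pos ξ s) d u)) := measurable_from_prod_countable_left h
  have h3 : Measurable fun ξ => (ξ, M.deg ξ s u) := measurable_id.prodMk (M.measurable_deg hs u)
  exact (h2.comp h3).const_mul M.p

theorem measurable_expo (w : ℕ → ℝ) {s : ℕ} (hs : 1 ≤ s) (a b : ℕ) :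
    Measurable fun ξ => M.expo w ξ s a b := by
  refine Finset.measurable_sum _ fun u _ => ?_
  exact (((M.measurable_link hs u).sub (M.measurable_linkProb hs u)).const_mul _).sub
    ((M.measurable_linkProb hs u).const_mul _)

theorem linkProb_update (ξ : Outcome m) (y : (Fin m → ℝ) × (ℕ → Bool)) {s u t : ℕ} (hs : s ≤ u)
    (h : t ≤ u) : M.linkProb (Function.update ξ (u + 1) y) s t = M.linkProb ξ s t := by
  rw [linkProb, linkProb, M.deg_update ξ y s h, pos, Function.update_of_ne (by omega)]
  rfl

theorem links_update (ξ : Outcome m) (y : (Fin m → ℝ) × (ℕ → Bool)) {s u t : ℕ} (hs : s ≤ u)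
    (h : t < u) : M.Links (Function.update ξ (u + 1) y) s t ↔ M.Links ξ s t := by
  have h1 : s ≠ u + 1 := by omega
  have h2 : t + 1 ≠ u + 1 := by omega
  unfold Links pos coin
  rw [M.deg_update ξ y s h.le, Function.update_of_ne h1, Function.update_of_ne h2]

theorem link_update (ξ : Outcome m) (y : (Fin m → ℝ) × (ℕ → Bool)) {s u t : ℕ} (hs : s ≤ u)
    (h : t < u) : M.link (Function.update ξ (u + 1) y) s t = M.link ξ s t := by
  have h1 := M.links_update ξ y hs h
  by_cases h2 : M.Links ξ s t
  · rw [link, link, if_pos h2, if_pos (h1.2 h2)]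
  · rw [link, link, if_neg h2, if_neg (mt h1.1 h2)]

theorem expo_update (w : ℕ → ℝ) (ξ : Outcome m) (y : (Fin m → ℝ) × (ℕ → Bool)) {s u : ℕ}
    (hs : s ≤ u) (a : ℕ) : M.expo w (Function.update ξ (u + 1) y) s a u = M.expo w ξ s a u := by
  refine Finset.sum_congr rfl fun t ht => ?_
  have := (Finset.mem_Ico.1 ht).2
  rw [M.link_update ξ y hs this, M.linkProb_update ξ y hs this.le]

theorem link_update_self (ξ : Outcome m) (y : (Fin m → ℝ) × (ℕ → Bool)) {s u : ℕ} (hs : s ≤ u) :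
    M.link (Function.update ξ (u + 1) y) s u =
      (M.sphere (pos ξ s) (M.deg ξ s u) u ×ˢ {b : ℕ → Bool | b s = true}).indicator
        (fun _ => 1) y := by
  classical
  have h1 : s ≠ u + 1 := by omega
  have h2 : M.Links (Function.update ξ (u + 1) y) s u ↔
      y ∈ M.sphere (pos ξ s) (M.deg ξ s u) u ×ˢ {b : ℕ → Bool | b s = true} := by
    unfold Links pos coin
    rw [M.deg_update ξ y s le_rfl, Function.update_of_ne h1, Function.update_self]
    rfl
  by_cases h3 : M.Links (Function.update ξ (u + 1) y) s u
  · rw [link, if_pos h3, Set.indicator_of_mem (h2.1 h3)]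
  · rw [link, if_neg h3, Set.indicator_of_notMem (mt h2.2 h3)]

/-- With `q = ν A`, the bound `exp w ≤ 1 + w + w²` for `|w| ≤ 1` gives `E exp (w 1_A) ≤ 1 + q (w +
w²) ≤ exp (q (w + w²))`. The compensator cancels exactly this. -/
theorem _root_.MeasureTheory.lintegral_exp_compensated_indicator_le {Ω : Type*}
    [MeasurableSpace Ω] (ν : Measure Ω) [IsProbabilityMeasure ν] {A : Set Ω} (hA : MeasurableSet A)
    {w : ℝ} (hw : |w| ≤ 1) :
    ∫⁻ y, ENNReal.ofReal (Real.exp (w * (A.indicator (fun _ => 1) y - ν.real A) -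
      w ^ 2 * ν.real A)) ∂ν ≤ 1 := by
  set q := ν.real A with hq
  have hq0 : 0 ≤ q := measureReal_nonneg
  have hq1 : q ≤ 1 := measureReal_le_one
  have hqc : ν.real Aᶜ = 1 - q := by rw [hq, probReal_compl_eq_one_sub hA]
  have h1 : ∫⁻ y in A, ENNReal.ofReal
      (Real.exp (w * (A.indicator (fun _ => 1) y - q) - w ^ 2 * q)) ∂ν
      = ENNReal.ofReal (Real.exp (w * (1 - q) - w ^ 2 * q) * q) := by
    rw [setLIntegral_congr_fun
      (g := fun _ => ENNReal.ofReal (Real.exp (w * (1 - q) - w ^ 2 * q))) hA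
      (fun y hy => by simp only [Set.indicator_of_mem hy]), setLIntegral_const,
      ENNReal.ofReal_mul (Real.exp_nonneg _), hq,
      measureReal_def, ENNReal.ofReal_toReal (measure_ne_top _ _)]
  have h2 : ∫⁻ y in Aᶜ, ENNReal.ofReal
      (Real.exp (w * (A.indicator (fun _ => 1) y - q) - w ^ 2 * q)) ∂ν
      = ENNReal.ofReal (Real.exp (w * (0 - q) - w ^ 2 * q) * (1 - q)) := by
    rw [setLIntegral_congr_fun
      (g := fun _ => ENNReal.ofReal (Real.exp (w * (0 - q) - w ^ 2 * q))) hA.compl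
      (fun y hy => by
        have hy : y ∉ A := hy
        simp only [Set.indicator_of_notMem hy]), setLIntegral_const,
      ENNReal.ofReal_mul (Real.exp_nonneg _), ← hqc,
      measureReal_def, ENNReal.ofReal_toReal (measure_ne_top _ _)]
  rw [← lintegral_add_compl _ hA, h1, h2, ← ENNReal.ofReal_add (by positivity)
    (mul_nonneg (Real.exp_nonneg _) (by linarith))]
  refine ENNReal.ofReal_le_one.2 ?_
  have e1 : Real.exp (w * (1 - q) - w ^ 2 * q) = Real.exp w * Real.exp (-(w * q) - w ^ 2 * q) := by
    rw [← Real.exp_add]; ring_nf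
  have e2 : Real.exp (w * (0 - q) - w ^ 2 * q) = Real.exp (-(w * q) - w ^ 2 * q) := by ring_nf
  have e3 : Real.exp w ≤ 1 + w + w ^ 2 := by
    have := (abs_le.1 (Real.abs_exp_sub_one_sub_id_le hw)).2
    linarith
  rw [e1, e2]
  calc Real.exp w * Real.exp (-(w * q) - w ^ 2 * q) * q + Real.exp (-(w * q) - w ^ 2 * q) * (1 - q)
      = Real.exp (-(w * q) - w ^ 2 * q) * (1 + q * (Real.exp w - 1)) := by ring
    _ ≤ Real.exp (-(w * q) - w ^ 2 * q) * Real.exp (q * (w + w ^ 2)) := by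
        gcongr
        have := Real.add_one_le_exp (q * (w + w ^ 2))
        have : q * (Real.exp w - 1) ≤ q * (w + w ^ 2) := by
          gcongr
          linarith
        linarith
    _ = 1 := by
        rw [← Real.exp_add, ← Real.exp_zero]; ring_nf

/-- Supermartingale property: redraw node `b + 1`. The earlier terms and the link probability at
time `b` do not see it, and the new factor has integral at most 1. The condition `s ≤ a` ensures
that the redrawn node is never `v_s` itself. -/
theorem lintegral_exp_expo_le_one {w : ℕ → ℝ} (hw : ∀ u, |w u| ≤ 1) {s a : ℕ} (hs : 1 ≤ s)
    (hsa : s ≤ a) (b : ℕ) :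
    ∫⁻ ξ, ENNReal.ofReal (Real.exp (M.expo w ξ s a b)) ∂M.prob ≤ 1 := by
  induction b with
  | zero => simp [expo]
  | succ b ih =>
    rcases lt_or_ge b a with hb | hb
    · simp [expo, Finset.Ico_eq_empty_of_le (Nat.succ_le_of_lt hb)]
    have hsb : s ≤ b := hsa.trans hb
    have hmeas : Measurable fun ξ => ENNReal.ofReal (Real.exp (M.expo w ξ s a (b + 1))) :=
      (Real.measurable_exp.comp (M.measurable_expo w hs a (b + 1))).ennreal_ofReal
    have hupd : Measurable fun q : Outcome m × ((Fin m → ℝ) × (ℕ → Bool)) =>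
        Function.update q.1 (b + 1) q.2 := measurable_update'
    calc ∫⁻ ξ, ENNReal.ofReal (Real.exp (M.expo w ξ s a (b + 1))) ∂M.prob
        = ∫⁻ ξ, ∫⁻ y, ENNReal.ofReal (Real.exp
            (M.expo w (Function.update ξ (b + 1) y) s a (b + 1))) ∂M.nodeLaw ∂M.prob := by
          conv_lhs => rw [← M.map_update_prob (b + 1)]
          rw [lintegral_map hmeas hupd]
          exact lintegral_prod _ (hmeas.comp hupd).aemeasurable
      _ ≤ ∫⁻ ξ, ENNReal.ofReal (Real.exp (M.expo w ξ s a b)) ∂M.prob := by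
          refine lintegral_mono fun ξ => ?_
          have hS : MeasurableSet (M.sphere (pos ξ s) (M.deg ξ s b) b) :=
            measurable_prodMk_left (M.measurableSet_sphere_graph (M.deg ξ s b) b)
          have hA : MeasurableSet (M.sphere (pos ξ s) (M.deg ξ s b) b ×ˢ
              {c : ℕ → Bool | c s = true}) :=
            hS.prod (measurableSet_eq_fun (measurable_pi_apply s) measurable_const)
          have hq : M.linkProb ξ s b = M.nodeLaw.real (M.sphere (pos ξ s) (M.deg ξ s b) b ×ˢ
              {c : ℕ → Bool | c s = true}) := (M.nodeLaw_prod _ s).symm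
          have hsplit : ∀ y, M.expo w (Function.update ξ (b + 1) y) s a (b + 1) =
              M.expo w ξ s a b + (w b * (M.link (Function.update ξ (b + 1) y) s b -
                M.linkProb ξ s b) - w b ^ 2 * M.linkProb ξ s b) := by
            intro y
            rw [← M.expo_update w ξ y hsb a, ← M.linkProb_update ξ y hsb le_rfl, expo, expo,
              Finset.sum_Ico_succ_top hb]
          simp only [hsplit, Real.exp_add, ENNReal.ofReal_mul (Real.exp_nonneg _)]
          rw [lintegral_const_mul' _ _ ENNReal.ofReal_ne_top]
          simp only [M.link_update_self ξ _ hsb, hq]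
          exact mul_le_of_le_one_right zero_le
            (lintegral_exp_compensated_indicator_le M.nodeLaw hA (hw b))
      _ ≤ 1 := ih

theorem prob_le_expo {w : ℕ → ℝ} (hw : ∀ u, |w u| ≤ 1) {s a : ℕ} (hs : 1 ≤ s)
    (hsa : s ≤ a) (b : ℕ) (L : ℝ) :
    M.prob.real {ξ | L ≤ M.expo w ξ s a b} ≤ Real.exp (-L) := by
  have hmeas : Measurable fun ξ => ENNReal.ofReal (Real.exp (M.expo w ξ s a b)) :=
    (Real.measurable_exp.comp (M.measurable_expo w hs a b)).ennreal_ofReal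
  have h1 := (mul_meas_ge_le_lintegral (μ := M.prob) hmeas (ENNReal.ofReal (Real.exp L))).trans
    (M.lintegral_exp_expo_le_one hw hs hsa b)
  have h2 : {ξ | ENNReal.ofReal (Real.exp L) ≤ ENNReal.ofReal (Real.exp (M.expo w ξ s a b))}
      = {ξ | L ≤ M.expo w ξ s a b} := by
    ext ξ
    simp only [Set.mem_ofPred_eq]
    rw [ENNReal.ofReal_le_ofReal_iff (Real.exp_nonneg _), Real.exp_le_exp]
  rw [h2] at h1
  have h3 := ENNReal.toReal_mono ENNReal.one_ne_top h1
  rw [ENNReal.toReal_mul, ENNReal.toReal_ofReal (Real.exp_nonneg _), ENNReal.toReal_one] at h3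
  rw [Real.exp_neg, ← one_div, le_div_iff₀' (Real.exp_pos _)]
  exact h3

end SPAModel

/-! ### The expected growth factor -/

/-- The factor by which a quantity with drift `α y / u` at time `u` grows from time `a` to
time `b`. -/
def growth (α : ℝ) (a b : ℕ) : ℝ := ∏ i ∈ Finset.Ico a b, (1 + α / i)

theorem growth_self (α : ℝ) (a : ℕ) : growth α a a = 1 := by simp [growth]

theorem one_le_growth {α : ℝ} (h : 0 ≤ α) (a b : ℕ) : 1 ≤ growth α a b := by
  refine Finset.prod_induction _ (fun x => 1 ≤ x) (fun _ _ => one_le_mul_of_one_le_of_one_le) le_rfl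
    fun i _ => ?_
  have : 0 ≤ α / i := by positivity
  linarith

theorem growth_pos {α : ℝ} (h : 0 ≤ α) (a b : ℕ) : 0 < growth α a b :=
  one_pos.trans_le (one_le_growth h a b)

theorem growth_mul_growth (α : ℝ) {a b c : ℕ} (hab : a ≤ b) (hbc : b ≤ c) :
    growth α a b * growth α b c = growth α a c :=
  Finset.prod_Ico_consecutive _ hab hbc

theorem growth_succ (α : ℝ) {a b : ℕ} (hab : a ≤ b) :
    growth α a (b + 1) = growth α a b * (1 + α / b) :=
  Finset.prod_Ico_succ_top hab _

/-- Each term is `1 / growth α t u - 1 / growth α t (u + 1)`, so the sum telescopes. -/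
theorem sum_div_growth {α : ℝ} (h : 0 ≤ α) {t n : ℕ} (htn : t ≤ n) :
    ∑ u ∈ Finset.Ico t n, α / u / growth α t (u + 1) = 1 - 1 / growth α t n := by
  induction n, htn using Nat.le_induction with
  | base => simp [growth_self]
  | succ n hn ih =>
    have h1 := growth_pos h t n
    have h2 : 0 < 1 + α / n := by positivity
    rw [Finset.sum_Ico_succ_top hn, ih, growth_succ α hn]
    generalize α / (n : ℝ) = x at *
    field_simp
    ring

/-- Bernoulli's inequality `(1 + 1 / n) ^ α ≤ 1 + α / n`, multiplied over the steps. -/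
theorem rpow_le_growth {α : ℝ} (h0 : 0 ≤ α) (h1 : α ≤ 1) {t n : ℕ} (ht : 1 ≤ t) (htn : t ≤ n) :
    ((n : ℝ) / t) ^ α ≤ growth α t n := by
  have ht' : (0 : ℝ) < t := by exact_mod_cast ht
  induction n, htn using Nat.le_induction with
  | base => rw [growth_self, div_self ht'.ne', Real.one_rpow]
  | succ n hn ih =>
    have hn' : (0 : ℝ) < n := ht'.trans_le (by exact_mod_cast hn)
    have h2 : (((n + 1 : ℕ) : ℝ) / t) = (n / t) * (1 + 1 / n) := by
      push_cast
      field_simp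
    rw [h2, Real.mul_rpow (by positivity) (by positivity), growth_succ α hn]
    have h3 := rpow_one_add_le_one_add_mul_self (s := 1 / (n : ℝ))
      (by linarith [show (0 : ℝ) ≤ 1 / n by positivity]) h0 h1
    rw [mul_one_div] at h3
    exact mul_le_mul ih h3 (by positivity) (growth_pos h0 _ _).le

theorem growth_le_rpow {α : ℝ} (h0 : 0 ≤ α) (h1 : α ≤ 1) {t n : ℕ} (ht : 2 ≤ t) (htn : t ≤ n) :
    growth α t n ≤ ((n : ℝ) / t) ^ α * (t / (t - 1)) := by
  have ht' : (2 : ℝ) ≤ t := by exact_mod_cast ht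
  have ht1 : (0 : ℝ) < (t : ℝ) - 1 := by linarith
  -- Shifting by one makes the comparison telescope: `1 + α / n ≤ exp (α / n) ≤ (n / (n - 1)) ^ α`.
  -- Undoing the shift costs the factor `t / (t - 1)`.
  have key : growth α t n ≤ (((n : ℝ) - 1) / (t - 1)) ^ α := by
    induction n, htn using Nat.le_induction with
    | base => rw [growth_self, div_self ht1.ne', Real.one_rpow]
    | succ n hn ih =>
      have hn' : (t : ℝ) ≤ n := by exact_mod_cast hn
      have hn1 : (0 : ℝ) < (n : ℝ) - 1 := by linarith
      have hn0 : (0 : ℝ) < n := by linarith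
      have h2 : (((n + 1 : ℕ) : ℝ) - 1) / (t - 1) = ((n - 1) / (t - 1)) * (n / (n - 1)) := by
        push_cast
        field_simp
        ring
      rw [h2, Real.mul_rpow (by positivity) (by positivity), growth_succ α hn]
      refine mul_le_mul ih ?_ (by positivity) (by positivity)
      have h3 := Real.one_sub_inv_le_log_of_pos (show (0 : ℝ) < n / (n - 1) by positivity)
      have h4 : 1 - ((n : ℝ) / (n - 1))⁻¹ = 1 / n := by
        field_simp
        ring
      rw [h4] at h3
      rw [Real.rpow_def_of_pos (by positivity)]
      have h5 := Real.add_one_le_exp (α / n)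
      calc 1 + α / n ≤ Real.exp (α / n) := by linarith
        _ ≤ Real.exp (Real.log (n / (n - 1)) * α) := by
          refine Real.exp_le_exp.2 ?_
          calc α / n = 1 / n * α := by ring
            _ ≤ _ := by gcongr
  have hn' : (t : ℝ) ≤ n := by exact_mod_cast htn
  calc growth α t n ≤ (((n : ℝ) - 1) / (t - 1)) ^ α := key
    _ ≤ (n / t * (t / (t - 1))) ^ α := by
      refine Real.rpow_le_rpow (div_nonneg (by linarith) ht1.le) ?_ h0
      have : (n : ℝ) / t * (t / (t - 1)) = n / (t - 1) := by field_simp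
      rw [this]
      gcongr
      linarith
    _ = (n / t) ^ α * (t / (t - 1)) ^ α := Real.mul_rpow (by positivity) (by positivity)
    _ ≤ _ := by
      gcongr
      have : (1 : ℝ) ≤ t / (t - 1) := by
        rw [le_div_iff₀ ht1]
        linarith
      exact Real.rpow_le_self_of_one_le this h1

/-- A sequence whose compensated increments, discounted by the growth factor, are controlled
by exponential bounds is close to its extrapolation from the final time. -/
theorem abs_sub_div_growth_le {α : ℝ} (h0 : 0 ≤ α) {t n : ℕ} (htn : t < n) (ht : 1 ≤ t)
    {Y I q : ℕ → ℝ} {θ L : ℝ} (hθ : 0 < θ)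
    (hstep : ∀ u, t ≤ u → u < n → Y (u + 1) = Y u + I u)
    (hq : ∀ u, t ≤ u → u < n → q u = α * Y u / u)
    (hmono : Y t ≤ Y (t + 1)) (hYn : 0 ≤ Y n)
    (hY : ∀ u, t < u → u ≤ n → Y u ≤ 2 * (Y n / growth α u n))
    (hexp : ∀ σ : ℝ, |σ| = 1 → ∑ u ∈ Finset.Ico t n, (σ * θ / growth α t (u + 1) * (I u - q u) -
      (σ * θ / growth α t (u + 1)) ^ 2 * q u) ≤ L) :
    |Y t - Y n / growth α t n| ≤ 2 * θ * (Y n / growth α t n) + L / θ := by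
  have hg := fun a b => growth_pos h0 a b
  -- Linear drift turns each term into `Y (u + 1) / growth α t (u + 1) - Y u / growth α t u`; this
  -- is why the discount is taken at `u + 1`.
  have hS1 : ∀ k, t ≤ k → k ≤ n → ∑ u ∈ Finset.Ico t k, (I u - q u) / growth α t (u + 1)
      = Y k / growth α t k - Y t := by
    intro k hk
    induction k, hk using Nat.le_induction with
    | base => simp [growth_self]
    | succ k hk ih =>
      intro hkn
      have hk0 : (0 : ℝ) < k := by exact_mod_cast (by omega : 0 < k)
      have h1 : 0 < 1 + α / k := by positivity
      have h2 := hg t k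
      have h3 : k + α ≠ 0 := by positivity
      rw [Finset.sum_Ico_succ_top hk, ih (by omega), hstep k hk (by omega), hq k hk (by omega),
        growth_succ α hk]
      field_simp
      ring
  have hD : ∀ u, t ≤ u → u < n → Y u / growth α t (u + 1) ≤ 2 * (Y n / growth α t n) := by
    have key : ∀ u, t < u → u ≤ n → ∀ y, y ≤ Y u → y / growth α t u ≤ 2 * (Y n / growth α t n) := by
      intro u hu hun y hy
      rw [← growth_mul_growth α hu.le hun]
      calc y / growth α t u ≤ 2 * (Y n / growth α u n) / growth α t u :=
            div_le_div_of_nonneg_right (hy.trans (hY u hu hun)) (hg _ _).le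
        _ = _ := by
            have := hg t u
            have := hg u n
            field_simp
    intro u hu hun
    rcases hu.eq_or_lt with rfl | hu
    -- At `u = t` no upper bound on `Y t` is available yet; monotonicity transfers the one at `t +
    -- 1`, and the discount at `u + 1` matches.
    · exact key (t + 1) (by omega) (by omega) _ hmono
    · have h1 := key u hu hun.le _ le_rfl
      have hpos : 0 ≤ 2 * (Y n / growth α t n) := by
        have := hg t n
        positivity
      rcases le_total 0 (Y u) with hy | hy
      · refine (div_le_div_of_nonneg_left hy (hg _ _) ?_).trans h1
        rw [growth_succ α hu.le]
        have : 0 ≤ α / (u : ℝ) := by positivity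
        nlinarith [hg t u]
      · exact (div_nonpos_of_nonpos_of_nonneg hy (hg _ _).le).trans hpos
  -- Quadratic variation: one discount factor is absorbed by `hD`, and the other leaves the
  -- telescoping sum, which is at most 1.
  have hS2 : ∑ u ∈ Finset.Ico t n, q u / growth α t (u + 1) ^ 2 ≤ 2 * (Y n / growth α t n) := by
    have hpos : 0 ≤ 2 * (Y n / growth α t n) := by
      have := hg t n
      positivity
    calc ∑ u ∈ Finset.Ico t n, q u / growth α t (u + 1) ^ 2
        ≤ ∑ u ∈ Finset.Ico t n, 2 * (Y n / growth α t n) * (α / u / growth α t (u + 1)) := by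
          refine Finset.sum_le_sum fun u hu => ?_
          obtain ⟨h1, h2⟩ := Finset.mem_Ico.1 hu
          have hu0 : (0 : ℝ) < u := by exact_mod_cast (by omega : 0 < u)
          have h3 := hg t (u + 1)
          rw [hq u h1 h2]
          calc α * Y u / u / growth α t (u + 1) ^ 2
              = Y u / growth α t (u + 1) * (α / u / growth α t (u + 1)) := by field_simp
            _ ≤ _ := mul_le_mul_of_nonneg_right (hD u h1 h2) (by positivity)
      _ = 2 * (Y n / growth α t n) * (1 - 1 / growth α t n) := by
          rw [← Finset.mul_sum, sum_div_growth h0 htn.le]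
      _ ≤ 2 * (Y n / growth α t n) := by
          refine mul_le_of_le_one_right hpos ?_
          have : 0 ≤ 1 / growth α t n := one_div_nonneg.2 (hg _ _).le
          linarith
  have hsum : ∀ σ : ℝ, |σ| = 1 →
      σ * θ * (Y n / growth α t n - Y t) - θ ^ 2 * (2 * (Y n / growth α t n)) ≤ L := by
    intro σ hσ
    have hσ2 : σ ^ 2 = 1 := by rw [← sq_abs, hσ, one_pow]
    refine le_trans ?_ (hexp σ hσ)
    rw [← hS1 n htn.le le_rfl, Finset.sum_sub_distrib]
    have e1 : ∑ u ∈ Finset.Ico t n, σ * θ / growth α t (u + 1) * (I u - q u)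
        = σ * θ * ∑ u ∈ Finset.Ico t n, (I u - q u) / growth α t (u + 1) := by
      rw [Finset.mul_sum]
      exact Finset.sum_congr rfl fun u _ => by ring
    have e2 : ∑ u ∈ Finset.Ico t n, (σ * θ / growth α t (u + 1)) ^ 2 * q u
        = θ ^ 2 * ∑ u ∈ Finset.Ico t n, q u / growth α t (u + 1) ^ 2 := by
      rw [Finset.mul_sum]
      refine Finset.sum_congr rfl fun u _ => ?_
      rw [div_pow, mul_pow, hσ2]
      ring
    rw [e1, e2]
    have := mul_le_mul_of_nonneg_left hS2 (sq_nonneg θ)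
    linarith
  have hp := hsum 1 (by simp)
  have hm := hsum (-1) (by simp)
  have hL : L = θ * (L / θ) := by field_simp
  rw [hL] at hp hm
  rw [abs_le]
  constructor
  · refine le_of_mul_le_mul_left ?_ hθ
    linarith
  · refine le_of_mul_le_mul_left ?_ hθ
    linarith

/-! ### In-degrees on the good event -/

namespace SPAModel

variable {m : ℕ} (M : SPAModel m)

/-- The exponent `p ρ A₁` of the growth of in-degrees in the region with index `j`. -/
def exponent (j : Fin m → Fin M.K) : ℝ := M.p * M.ρ j * M.A₁

theorem exponent_nonneg (j : Fin m → Fin M.K) : 0 ≤ M.exponent j :=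
  mul_nonneg (mul_nonneg M.p_pos.le (M.ρ_nonneg j)) M.A₁_pos.le

theorem exponent_lt_one (j : Fin m → Fin M.K) : M.exponent j < 1 := by
  have := M.subcritical j
  rw [exponent]
  linarith

/-- The discounted weights of the increments after time `t`. -/
def weight (j : Fin m → Fin M.K) (t : ℕ) (θ : ℝ) (u : ℕ) : ℝ :=
  θ / growth (M.exponent j) t (u + 1)

theorem abs_weight_le_one (j : Fin m → Fin M.K) (t : ℕ) {θ : ℝ} (h : |θ| ≤ 1) (u : ℕ) :
    |M.weight j t θ u| ≤ 1 := by
  have h1 := one_le_growth (M.exponent_nonneg j) t (u + 1)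
  rw [weight, abs_div, abs_of_pos (one_pos.trans_le h1)]
  exact div_le_one_of_le₀ (h.trans h1) (zero_le_one.trans h1)

/-- All exponential supermartingales stay below the level `4 log n`. -/
def ExposBounded (ξ : Outcome m) (n : ℕ) (θ : ℝ) : Prop :=
  ∀ s ∈ Finset.Icc 1 n, ∀ t ∈ Finset.Icc s n, ∀ j, ∀ σ ∈ ({1, -1} : Finset ℝ),
    M.expo (M.weight j t (σ * θ)) ξ s t n < 4 * Real.log n

/-- The sphere lies inside the region, so its mass is density times volume; the shift `A₂ / A₁`
makes the drift exactly linear. -/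
theorem linkProb_eq {ξ : Outcome m} {s u : ℕ} {j : Fin m → Fin M.K} (hj : pos ξ s ∈ M.region j)
    (hδ : 0 ≤ M.boundaryDist j (pos ξ s))
    (h : (M.A₁ * M.deg ξ s u + M.A₂) / u <
      M.unitBallVolume * M.boundaryDist j (pos ξ s) ^ m) :
    M.linkProb ξ s u = M.exponent j * (M.deg ξ s u + M.A₂ / M.A₁) / u := by
  have h1 := M.A₁_pos
  have h2 := M.A₂_pos
  rw [linkProb, sphere, M.positionLaw_ballOfVolume hj (by positivity) hδ h, exponent]
  field_simp

/-- The role of `T_v`: from then on the predicted degree is at least `ω log n`, large enough to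
dominate the fluctuations. -/
theorem le_rpow_of_timeT_le {j : Fin m → Fin M.K} (hj : 0 < M.exponent j) {w : ℝ} {n k t : ℕ}
    (hk : 0 < k) (hn : 0 < n) (hw : 0 ≤ w * Real.log n) (h : M.timeT j w n k ≤ t) :
    w * Real.log n ≤ k * ((t : ℝ) / n) ^ M.exponent j := by
  have hk' : (0 : ℝ) < k := by exact_mod_cast hk
  have hn' : (0 : ℝ) < n := by exact_mod_cast hn
  change n * (w * Real.log n / k) ^ (1 / M.exponent j) ≤ t at h
  rw [← le_div_iff₀' hn'] at h
  have h1 := Real.rpow_le_rpow (by positivity) h hj.le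
  rw [← Real.rpow_mul (by positivity), one_div_mul_cancel hj.ne', Real.rpow_one,
    div_le_iff₀' hk'] at h1
  exact h1

/-- The role of `t_v`: from then on a sphere of the predicted volume fits in the region, with a
spare factor `(1 + ε) ^ (1 - α) > 1` that absorbs the errors of the prediction. -/
theorem le_of_timet_le {j : Fin m → Fin M.K} {ε δ : ℝ} (hε : 0 < ε) (hδ : 0 < δ) {n k t : ℕ}
    (hn : 0 < n) (ht : 0 < t) (h : M.timet j ε δ n k ≤ t) :
    M.A₁ * (k * ((t : ℝ) / n) ^ M.exponent j) * (1 + ε) ^ (1 - M.exponent j) ≤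
      t * (M.unitBallVolume * δ ^ m) := by
  have hA := M.A₁_pos
  have hc := M.unitBallVolume_pos
  have hn' : (0 : ℝ) < n := by exact_mod_cast hn
  have ht' : (0 : ℝ) < t := by exact_mod_cast ht
  have hα : 0 < 1 - M.exponent j := by linarith [M.exponent_lt_one j]
  set α := M.exponent j with hαd
  change (1 + ε) * (M.A₁ * k / (δ ^ m * M.unitBallVolume * (n : ℝ) ^ α)) ^ (1 / (1 - α)) ≤ t at h
  rw [← le_div_iff₀' (by linarith)] at h
  have h1 := Real.rpow_le_rpow (by positivity) h hα.le
  rw [← Real.rpow_mul (by positivity), one_div_mul_cancel hα.ne', Real.rpow_one,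
    Real.div_rpow ht'.le (by linarith), div_le_div_iff₀ (by positivity) (by positivity)] at h1
  rw [Real.div_rpow ht'.le hn'.le]
  have h2 : (t : ℝ) ^ (1 - α) * t ^ α = t := by
    rw [← Real.rpow_add ht']
    simp
  have hna : 0 < (n : ℝ) ^ α := by positivity
  have hta : 0 < (t : ℝ) ^ α := by positivity
  calc M.A₁ * (k * (t ^ α / n ^ α)) * (1 + ε) ^ (1 - α)
      = M.A₁ * k * (1 + ε) ^ (1 - α) * (t ^ α / n ^ α) := by ring
    _ ≤ t ^ (1 - α) * (δ ^ m * M.unitBallVolume * n ^ α) * (t ^ α / n ^ α) := by gcongr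
    _ = (t ^ (1 - α) * t ^ α) * (M.unitBallVolume * δ ^ m) := by field_simp
    _ = _ := by rw [h2]

theorem deg_le (ξ : Outcome m) {s : ℕ} (hs : 1 ≤ s) (t : ℕ) : M.deg ξ s t ≤ t :=
  (M.deg_le_succ ξ hs t).trans (M.deg_succ_le ξ hs t)

/-- Extrapolating backwards from the final in-degree `k`, up to relative error `10 θ`, together
with a lower bound on the time. -/
theorem abs_deg_sub_div_growth_le {ξ : Outcome m} {n s : ℕ} (hs : 1 ≤ s)
    {j : Fin m → Fin M.K} (hj : pos ξ s ∈ M.region j) (hα : 0 < M.exponent j)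
    {w ε θ : ℝ} (hε : 0 < ε) (hθ : 0 < θ) (hθw : θ ^ 2 * w = 1) (hθ1 : 20 * θ ≤ 1)
    (hlog : 1 ≤ Real.log n) (hw : 8 * (M.A₂ / M.A₁ + 2) ≤ w)
    (hslack : (1 + 10 * θ) * (1 + M.A₂ / M.A₁ / w) * (1 + 8 / w) <
      (1 + ε) ^ (1 - M.exponent j))
    (hgood : M.ExposBounded ξ n θ) (hk : w ^ 2 * Real.log n ≤ M.deg ξ s n)
    (hδ : 0 < M.boundaryDist j (pos ξ s)) {t : ℕ}
    (ht : max (M.timet j ε (M.boundaryDist j (pos ξ s)) n (M.deg ξ s n))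
      (M.timeT j w n (M.deg ξ s n)) ≤ t) (htn : t ≤ n) :
    w / 8 ≤ t ∧
      |(M.deg ξ s t + M.A₂ / M.A₁) -
          (M.deg ξ s n + M.A₂ / M.A₁) / growth (M.exponent j) t n| ≤
        10 * θ * ((M.deg ξ s n + M.A₂ / M.A₁) / growth (M.exponent j) t n) := by
  set B := M.A₂ / M.A₁ with hB
  set α := M.exponent j with hαd
  set k := M.deg ξ s n with hkd
  set δ := M.boundaryDist j (pos ξ s) with hδd
  have hA₁ := M.A₁_pos
  have hA₂ := M.A₂_pos
  have hB0 : 0 < B := by positivity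
  have hw16 : 16 ≤ w := by linarith
  have hw0 : 0 < w := by linarith
  have hα1 : α < 1 := M.exponent_lt_one j
  have hwk : w ≤ k := by
    refine le_trans ?_ hk
    calc w = w * 1 * 1 := by ring
      _ ≤ w * w * Real.log n := by gcongr; linarith
      _ = _ := by ring
  have hkn : (k : ℝ) ≤ n := by exact_mod_cast M.deg_le ξ hs n
  have hk0 : 0 < k := by
    have : (0 : ℝ) < k := by linarith
    exact_mod_cast this
  have hn0 : 0 < n := by
    have : (0 : ℝ) < n := by linarith
    exact_mod_cast this
  have hn0' : (0 : ℝ) < n := by exact_mod_cast hn0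
  have hg := fun a b => growth_pos hα.le a b
  -- The factor `1 / 2` pays for `u / (u - 1) ≤ 2` in `growth_le_rpow`.
  have hlow : ∀ u : ℕ, 2 ≤ u → u ≤ n → M.timeT j w n k ≤ u →
      w * Real.log n / 2 ≤ (k + B) / growth α u n := by
    intro u hu hun hT
    have h1 := M.le_rpow_of_timeT_le hα hk0 hn0 (by positivity) hT
    have h2 := growth_le_rpow hα.le hα1.le hu hun
    have hu' : (2 : ℝ) ≤ u := by exact_mod_cast hu
    have h3 : (u : ℝ) / (u - 1) ≤ 2 := by
      rw [div_le_iff₀ (by linarith)]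
      linarith
    rw [le_div_iff₀ (hg u n)]
    have hx : 0 < ((n : ℝ) / u) ^ α := by positivity
    have hinv : ((u : ℝ) / n) ^ α * ((n : ℝ) / u) ^ α = 1 := by
      rw [← Real.mul_rpow (by positivity) (by positivity), div_mul_div_cancel₀ hn0'.ne',
        div_self (by positivity), Real.one_rpow]
    calc w * Real.log n / 2 * growth α u n
        ≤ w * Real.log n / 2 * (((n : ℝ) / u) ^ α * 2) := by
          gcongr
          exact h2.trans (by gcongr)
      _ = w * Real.log n * ((n : ℝ) / u) ^ α := by ring
      _ ≤ k * ((u : ℝ) / n) ^ α * ((n : ℝ) / u) ^ α := by gcongr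
      _ = k := by rw [mul_assoc, hinv, mul_one]
      _ ≤ k + B := by linarith
  have hup : ∀ u : ℕ, 1 ≤ u → u ≤ n →
      (k + B) / growth α u n ≤ (k + B) * ((u : ℝ) / n) ^ α := by
    intro u hu hun
    have hu' : (0 : ℝ) < u := by exact_mod_cast hu
    have h1 := rpow_le_growth hα.le hα1.le hu hun
    rw [div_eq_mul_inv]
    gcongr
    rw [← inv_div, Real.inv_rpow (by positivity)]
    exact inv_anti₀ (by positivity) h1
  induction hN : n - t using Nat.strong_induction_on generalizing t with
  | _ N ih =>
  rcases htn.eq_or_lt with rfl | htn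
  · refine ⟨by linarith, ?_⟩
    rw [growth_self, div_one, sub_self, abs_zero]
    positivity
  have hind : ∀ u : ℕ, t < u → u ≤ n → w / 8 ≤ u ∧
      |(M.deg ξ s u + B) - (k + B) / growth α u n| ≤ 10 * θ * ((k + B) / growth α u n) :=
    fun u hu hun => ih (n - u) (by omega) hun
      (ht.trans (by exact_mod_cast hu.le)) rfl
  have hTle : ∀ u : ℕ, t ≤ u → M.timeT j w n k ≤ u := fun u hu =>
    ((le_max_right _ _).trans ht).trans (by exact_mod_cast hu)
  have htle : ∀ u : ℕ, t ≤ u → M.timet j ε δ n k ≤ u := fun u hu =>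
    ((le_max_left _ _).trans ht).trans (by exact_mod_cast hu)
  obtain ⟨h8, hnext⟩ := hind (t + 1) (by omega) htn
  have ht2 : 2 ≤ t + 1 := by
    have : (2 : ℝ) ≤ ((t + 1 : ℕ) : ℝ) := by linarith
    exact_mod_cast this
  -- The estimate at `t + 1` with `10 θ ≤ 1 / 2` gives degree at least `w / 4 - B`, and `B ≤ w / 8`.
  -- This bounds `t` from below and shows that `v_s` is already born at time `t`.
  have hdeg : w / 8 ≤ M.deg ξ s (t + 1) := by
    have h1 := hlow (t + 1) ht2 htn (hTle _ (by omega))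
    have h2 := (abs_le.1 hnext).1
    have h3 : w * 1 ≤ w * Real.log n := by gcongr
    set D := ((k : ℝ) + B) / growth α (t + 1) n
    have h4 : 10 * θ * D ≤ 1 / 2 * D := by
      have : 0 ≤ D := by linarith
      gcongr
      linarith
    linarith
  have ht8 : w / 8 ≤ t := hdeg.trans (by exact_mod_cast M.deg_succ_le ξ hs t)
  refine ⟨ht8, ?_⟩
  have htpos : (0 : ℝ) < t := by linarith
  have ht0 : 0 < t := by exact_mod_cast htpos
  have ht2' : 2 ≤ t := by
    have : (2 : ℝ) ≤ t := by linarith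
    exact_mod_cast this
  have hst : s ≤ t := by
    by_contra! h
    rw [M.deg_eq_zero ξ hs (by omega : t + 1 ≤ s), Nat.cast_zero] at hdeg
    linarith
  -- The three factors account for the relative error at later times, for replacing `k + B` by `k`,
  -- and for the step from `t + 1` back to `t`, where only monotonicity of the degree is known.
  have hbound : ∀ u, t ≤ u → u < n →
      M.deg ξ s u + B ≤ (1 + 10 * θ) * (1 + B / w) * (1 + 8 / w) * (k * ((u : ℝ) / n) ^ α) := by
    have haux : ∀ u, t < u → u ≤ n →
        M.deg ξ s u + B ≤ (1 + 10 * θ) * (1 + B / w) * (k * ((u : ℝ) / n) ^ α) := by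
      intro u hu hun
      have h1 := (abs_le.1 (hind u hu hun).2).2
      have h2 := hup u (by omega) hun
      have h3 : (k : ℝ) + B ≤ (1 + B / w) * k := by
        have : B / w * w ≤ B / w * k := by gcongr
        rw [div_mul_cancel₀ _ hw0.ne'] at this
        linarith
      calc M.deg ξ s u + B ≤ (1 + 10 * θ) * ((k + B) / growth α u n) := by linarith
        _ ≤ (1 + 10 * θ) * (((1 + B / w) * k) * ((u : ℝ) / n) ^ α) := by
          gcongr
          exact h2.trans (by gcongr)
        _ = _ := by ring
    intro u hu hun
    have h8w : 0 ≤ 8 / w := by positivity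
    rcases hu.eq_or_lt with rfl | hu
    · have h1 : (M.deg ξ s t : ℝ) ≤ M.deg ξ s (t + 1) := by exact_mod_cast M.deg_le_succ ξ hs t
      have h2 := haux (t + 1) (by omega) htn
      have h3 : (((t + 1 : ℕ) : ℝ) / n) ^ α ≤ (t / n) ^ α * (1 + 8 / w) := by
        have e : ((t + 1 : ℕ) : ℝ) / n = t / n * (1 + 1 / t) := by
          push_cast
          field_simp
        rw [e, Real.mul_rpow (by positivity) (by positivity)]
        gcongr
        refine (Real.rpow_le_self_of_one_le ?_ hα1.le).trans ?_
        · have : (0 : ℝ) ≤ 1 / t := by positivity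
          linarith
        · have : 1 / (t : ℝ) ≤ 1 / (w / 8) := by gcongr
          rw [one_div_div] at this
          linarith
      calc (M.deg ξ s t : ℝ) + B ≤ M.deg ξ s (t + 1) + B := by linarith
        _ ≤ _ := h2
        _ ≤ (1 + 10 * θ) * (1 + B / w) * (k * ((t / n) ^ α * (1 + 8 / w))) := by gcongr
        _ = _ := by ring
    · refine (haux u hu hun.le).trans ?_
      have hP : 0 ≤ (1 + 10 * θ) * (1 + B / w) := by positivity
      have hK : 0 ≤ (k : ℝ) * ((u : ℝ) / n) ^ α := by positivity
      exact mul_le_mul_of_nonneg_right (le_mul_of_one_le_right hP (by linarith)) hK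
  have hq : ∀ u, t ≤ u → u < n → M.linkProb ξ s u = α * (M.deg ξ s u + B) / u := by
    intro u hu hun
    have hu0 : 0 < u := by omega
    have hu0' : (0 : ℝ) < u := by exact_mod_cast hu0
    refine M.linkProb_eq hj hδ.le ?_
    have h1 := M.le_of_timet_le hε hδ hn0 hu0 (htle u hu)
    have h2 : M.A₁ * M.deg ξ s u + M.A₂ = M.A₁ * (M.deg ξ s u + B) := by
      rw [hB]
      field_simp
    rw [h2, div_lt_iff₀ hu0']
    have hx : 0 < M.A₁ * (k * ((u : ℝ) / n) ^ α) := by positivity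
    calc M.A₁ * (M.deg ξ s u + B)
        ≤ M.A₁ * ((1 + 10 * θ) * (1 + B / w) * (1 + 8 / w) * (k * ((u : ℝ) / n) ^ α)) := by
          gcongr
          exact hbound u hu hun
      _ = M.A₁ * (k * ((u : ℝ) / n) ^ α) * ((1 + 10 * θ) * (1 + B / w) * (1 + 8 / w)) := by ring
      _ < M.A₁ * (k * ((u : ℝ) / n) ^ α) * (1 + ε) ^ (1 - α) := by gcongr
      _ ≤ _ := h1
      _ = _ := by ring
  have hcore := abs_sub_div_growth_le (L := 4 * Real.log n) (Y := fun u => M.deg ξ s u + B)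
    (I := fun u => M.link ξ s u) (q := fun u => M.linkProb ξ s u) hα.le htn ht0 hθ ?_ hq ?_ ?_ ?_ ?_
  · refine hcore.trans ?_
    have h1 := hlow t ht2' htn.le (hTle t le_rfl)
    set D := ((k : ℝ) + B) / growth α t n
    -- Here `θ² w = 1` balances the two errors: together with the term `2 θ D` this gives `10 θ D`.
    have h2 : 4 * Real.log n / θ ≤ 8 * θ * D := by
      rw [div_le_iff₀ hθ]
      calc 4 * Real.log n = 8 * (θ ^ 2 * w) * (Real.log n / 2) := by rw [hθw]; ring
        _ = 8 * θ ^ 2 * (w * Real.log n / 2) := by ring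
        _ ≤ 8 * θ ^ 2 * D := by gcongr
        _ = _ := by ring
    linarith
  · intro u hu hun
    classical
    rw [M.deg_succ ξ hs, link]
    by_cases h : M.Links ξ s u
    · rw [if_pos ⟨hst.trans hu, h⟩, if_pos h]
      push_cast
      ring
    · rw [if_neg fun h' => h h'.2, if_neg h]
      push_cast
      ring
  · have : (M.deg ξ s t : ℝ) ≤ M.deg ξ s (t + 1) := by exact_mod_cast M.deg_le_succ ξ hs t
    simpa using this
  · positivity
  · intro u hu hun
    have h1 := (abs_le.1 (hind u hu hun).2).2
    have h2 : 0 < ((k : ℝ) + B) / growth α u n := by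
      have := hg u n
      positivity
    have h3 : 10 * θ * ((k + B) / growth α u n) ≤ 1 * ((k + B) / growth α u n) := by
      gcongr
      linarith
    linarith
  · intro σ hσ
    have hmem : σ ∈ ({1, -1} : Finset ℝ) := by
      rcases (abs_eq one_pos.le).1 hσ with h | h <;> simp [h]
    exact (hgood s (Finset.mem_Icc.2 ⟨hs, hst.trans htn.le⟩) t
      (Finset.mem_Icc.2 ⟨hst, htn.le⟩) j σ hmem).le

/-- It remains to replace `growth` by a power and to remove the shift `B`. In the final constant, 10
is the extrapolation error, 8 comes from `1 / t ≤ 8 / w ≤ 8 θ`, and `2 B` from the shift, which is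
small because the predicted degree is at least `w`. -/
theorem degreesPredicted_of_exposBounded {ξ : Outcome m} {n : ℕ} {w ε θ : ℝ} (hε : 0 < ε)
    (hθ : 0 < θ) (hθw : θ ^ 2 * w = 1) (hθ1 : 20 * θ ≤ 1) (hlog : 1 ≤ Real.log n)
    (hw : 8 * (M.A₂ / M.A₁ + 2) ≤ w)
    (hslack : ∀ j, (1 + 10 * θ) * (1 + M.A₂ / M.A₁ / w) * (1 + 8 / w) <
      (1 + ε) ^ (1 - M.exponent j))
    (hgood : M.ExposBounded ξ n θ) :
    M.DegreesPredicted ξ n w ε ((18 + 2 * (M.A₂ / M.A₁)) * θ) := by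
  intro s hs hsn j hj k hk δ hδ hkw hrad t ht htn
  subst hk hδ
  have hA₁ := M.A₁_pos
  have hA₂ := M.A₂_pos
  have hc := M.unitBallVolume_pos
  have hB0 : 0 < M.A₂ / M.A₁ := by positivity
  have hw0 : 0 < w := by linarith
  have hn0 : 0 < n := by omega
  have hn0' : (0 : ℝ) < n := by exact_mod_cast hn0
  have hwk : 0 < (M.deg ξ s n : ℝ) := lt_of_lt_of_le (by positivity) hkw
  have hk0 : 0 < M.deg ξ s n := by exact_mod_cast hwk
  change |(M.deg ξ s t : ℝ) - M.deg ξ s n * ((t : ℝ) / n) ^ M.exponent j| ≤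
    (18 + 2 * (M.A₂ / M.A₁)) * θ * (M.deg ξ s n * ((t : ℝ) / n) ^ M.exponent j)
  rcases (M.exponent_nonneg j).eq_or_lt with h0 | hα
  -- In a region of density zero the exponent `1 / 0` of `T_v` is 0 by convention, so `T_v = n` and
  -- only `t = n` is left.
  · have hT : (n : ℝ) ≤ t := by
      refine le_trans (le_of_eq ?_) ((le_max_right _ _).trans ht)
      change (n : ℝ) = n * (w * Real.log n / M.deg ξ s n) ^ (1 / M.exponent j)
      rw [← h0, div_zero, Real.rpow_zero, mul_one]
    have : t = n := le_antisymm htn (by exact_mod_cast hT)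
    subst this
    rw [← h0, Real.rpow_zero, mul_one, sub_self, abs_zero]
    positivity
  -- The assumption on `δ(v)` enters through positivity alone; later containment of the spheres
  -- comes from `t_v`.
  have hδ0 : 0 < M.boundaryDist j (pos ξ s) := by
    refine lt_of_lt_of_le ?_ hrad
    unfold radius
    positivity
  obtain ⟨ht8, hmain⟩ := M.abs_deg_sub_div_growth_le hs hj hα hε hθ hθw hθ1 hlog hw (hslack j)
    hgood hkw hδ0 ht htn
  have hwt := M.le_rpow_of_timeT_le hα hk0 hn0 (by positivity) ((le_max_right _ _).trans ht)
  have ht2' : (2 : ℝ) ≤ t := by linarith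
  have ht2 : 2 ≤ t := by exact_mod_cast ht2'
  set B := M.A₂ / M.A₁ with hB
  set α := M.exponent j with hαd
  set k := M.deg ξ s n with hkd
  have hα1 : α < 1 := M.exponent_lt_one j
  have hg := growth_pos hα.le t n
  set x := ((t : ℝ) / n) ^ α with hx
  have hx0 : 0 < x := by positivity
  have hx1 : x ≤ 1 := by
    refine Real.rpow_le_one (by positivity) ?_ hα.le
    rw [div_le_one hn0']
    exact_mod_cast htn
  have hxinv : ((n : ℝ) / t) ^ α = x⁻¹ := by
    rw [hx, ← Real.inv_rpow (by positivity), inv_div]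
  have hup : (k + B) / growth α t n ≤ (k + B) * x := by
    have h1 := rpow_le_growth hα.le hα1.le (by omega : 1 ≤ t) htn
    rw [hxinv] at h1
    rw [div_eq_mul_inv]
    gcongr
    exact inv_le_of_inv_le₀ hx0 h1
  have hlow : (k + B) * x * (1 - 1 / t) ≤ (k + B) / growth α t n := by
    have h1 := growth_le_rpow hα.le hα1.le ht2 htn
    rw [hxinv] at h1
    have ht1 : (0 : ℝ) < t - 1 := by linarith
    rw [le_div_iff₀ hg]
    calc (k + B) * x * (1 - 1 / t) * growth α t n
        ≤ (k + B) * x * (1 - 1 / t) * (x⁻¹ * (t / (t - 1))) := by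
          have : (0 : ℝ) ≤ 1 - 1 / t := by
            rw [sub_nonneg, div_le_one (by linarith)]
            linarith
          gcongr
      _ = k + B := by
          field_simp
  set D := ((k : ℝ) + B) / growth α t n with hD
  have hθ2 : 1 / w ≤ θ := by
    rw [div_le_iff₀ hw0]
    have : θ ^ 2 * w ≤ θ * w := by
      gcongr
      nlinarith
    linarith
  have hkx : w ≤ k * x := by
    refine le_trans ?_ hwt
    exact le_mul_of_one_le_right hw0.le hlog
  have hkx0 : 0 < k * x := by positivity
  have hB1 : B ≤ B * θ * (k * x) := by
    calc B = B * (1 / w) * w := by field_simp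
      _ ≤ B * θ * (k * x) := by gcongr
  have ht1 : 1 / (t : ℝ) ≤ 8 * θ := by
    calc 1 / (t : ℝ) ≤ 1 / (w / 8) := by gcongr
      _ = 8 * (1 / w) := by field_simp
      _ ≤ 8 * θ := by gcongr
  have hBx : B * x ≤ B := mul_le_of_le_one_right hB0.le hx1
  have hD1 : D ≤ k * x + B := by linarith
  have hD2 : k * x - k * x * (8 * θ) ≤ D := by
    have h1 : k * x * (1 / (t : ℝ)) ≤ k * x * (8 * θ) := by gcongr
    have h2 : 0 ≤ B * x * (1 - 1 / (t : ℝ)) := by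
      have : (0 : ℝ) ≤ 1 - 1 / t := by linarith
      positivity
    have h3 : ((k : ℝ) + B) * x * (1 - 1 / t) =
      k * x - k * x * (1 / (t : ℝ)) + B * x * (1 - 1 / (t : ℝ)) := by ring
    linarith
  have hD3 : 10 * θ * D ≤ 10 * θ * (k * x) + B := by
    have : 10 * θ * D ≤ 10 * θ * (k * x + B) := by gcongr
    have : 10 * θ * B ≤ 1 * B := by
      gcongr
      linarith
    linarith
  obtain ⟨m1, m2⟩ := abs_le.1 hmain
  have hfin : (18 + 2 * B) * θ * (k * x) = 10 * θ * (k * x) + k * x * (8 * θ) +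
    2 * (B * θ * (k * x)) := by ring
  rw [hfin, abs_le]
  have : 0 ≤ k * x * (8 * θ) := by positivity
  constructor <;> linarith

/-! ### Union bound and conclusion -/

theorem prob_not_exposBounded_le {n : ℕ} (hn : 1 ≤ n) {θ : ℝ} (hθ0 : 0 ≤ θ) (hθ : θ ≤ 1) :
    M.prob.real {ξ | ¬ M.ExposBounded ξ n θ} ≤
      2 * Fintype.card (Fin m → Fin M.K) * ((n : ℝ) ^ 2)⁻¹ := by
  classical
  have hn' : (0 : ℝ) < n := by exact_mod_cast hn
  -- The region of `v_s` is random whereas the weights must be deterministic, so all regions are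
  -- included. At most `2 K ^ m n²` events of probability at most `n⁻⁴` remain.
  set P : Finset ((ℕ × ℕ) × (Fin m → Fin M.K) × ℝ) :=
    ((Finset.Icc 1 n ×ˢ Finset.Icc 1 n).filter fun q => q.1 ≤ q.2) ×ˢ
      (Finset.univ ×ˢ ({1, -1} : Finset ℝ)) with hP
  have hcard : (P.card : ℝ) ≤ n ^ 2 * (2 * Fintype.card (Fin m → Fin M.K)) := by
    have h1 : P.card ≤ (n * n) * (Fintype.card (Fin m → Fin M.K) * 2) := by
      rw [hP, Finset.card_product, Finset.card_product]
      refine Nat.mul_le_mul ((Finset.card_filter_le _ _).trans ?_)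
        (Nat.mul_le_mul le_rfl Finset.card_le_two)
      simp
    have h2 : (P.card : ℝ) ≤ (((n * n) * (Fintype.card (Fin m → Fin M.K) * 2) : ℕ) : ℝ) := by
      exact_mod_cast h1
    refine h2.trans (le_of_eq ?_)
    push_cast
    ring
  have hexp : Real.exp (-(4 * Real.log n)) = ((n : ℝ) ^ 4)⁻¹ := by
    rw [Real.exp_neg, mul_comm, Real.exp_mul, Real.exp_log hn']
    norm_cast
  have hsub : {ξ | ¬ M.ExposBounded ξ n θ} ⊆ ⋃ q ∈ P, {ξ | 4 * Real.log n ≤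
      M.expo (M.weight q.2.1 q.1.2 (q.2.2 * θ)) ξ q.1.1 q.1.2 n} := by
    intro ξ hξ
    simp only [ExposBounded, Set.mem_ofPred_eq] at hξ
    push Not at hξ
    obtain ⟨s, hs, t, ht, j, σ, hσ, h⟩ := hξ
    have hs := Finset.mem_Icc.1 hs
    have ht := Finset.mem_Icc.1 ht
    refine Set.mem_biUnion (x := ((s, t), j, σ)) ?_ h
    rw [hP, Finset.mem_coe]
    simp only [Finset.mem_product, Finset.mem_filter, Finset.mem_Icc, Finset.mem_univ, true_and]
    exact ⟨⟨⟨hs, hs.1.trans ht.1, ht.2⟩, ht.1⟩, hσ⟩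
  calc M.prob.real {ξ | ¬ M.ExposBounded ξ n θ}
      ≤ M.prob.real (⋃ q ∈ P, {ξ | 4 * Real.log n ≤
          M.expo (M.weight q.2.1 q.1.2 (q.2.2 * θ)) ξ q.1.1 q.1.2 n}) :=
        measureReal_mono hsub (measure_ne_top _ _)
    _ ≤ ∑ q ∈ P, M.prob.real {ξ | 4 * Real.log n ≤
          M.expo (M.weight q.2.1 q.1.2 (q.2.2 * θ)) ξ q.1.1 q.1.2 n} :=
        measureReal_biUnion_finset_le _ _
    _ ≤ ∑ q ∈ P, ((n : ℝ) ^ 4)⁻¹ := by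
        refine Finset.sum_le_sum fun q hq => ?_
        simp only [hP, Finset.mem_product, Finset.mem_filter, Finset.mem_Icc, Finset.mem_univ,
          true_and] at hq
        obtain ⟨⟨⟨⟨h1, -⟩, -⟩, h2⟩, h3⟩ := hq
        rw [← hexp]
        refine M.prob_le_expo (M.abs_weight_le_one _ _ ?_) h1 h2 n _
        have h4 : |q.2.2| = 1 := by
          rcases Finset.mem_insert.1 h3 with h | h
          · rw [h, abs_one]
          · rw [Finset.mem_singleton.1 h, abs_neg, abs_one]
        rw [abs_mul, h4, one_mul, abs_of_nonneg hθ0]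
        exact hθ
    _ = P.card * ((n : ℝ) ^ 4)⁻¹ := by rw [Finset.sum_const, nsmul_eq_mul]
    _ ≤ n ^ 2 * (2 * Fintype.card (Fin m → Fin M.K)) * ((n : ℝ) ^ 4)⁻¹ := by gcongr
    _ = _ := by field_simp

end SPAModel

end

theorem theorem1 {m : ℕ} (M : SPAModel m) (ω : ℕ → ℝ) (hω : Tendsto ω atTop atTop)
    (ε : ℝ) (hε : 0 < ε) :
    ∃ η : ℕ → ℝ, Tendsto η atTop (𝓝 0) ∧
      Tendsto (fun n : ℕ =>
          (n : ℝ) * M.prob.real {ξ | ¬ M.DegreesPredicted ξ n (ω n) ε (η n)})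
        atTop (𝓝 0) := by
  have hθ : Tendsto (fun n => (√(ω n))⁻¹) atTop (𝓝 0) :=
    (Real.tendsto_sqrt_atTop.comp hω).inv_tendsto_atTop
  have hslack : ∀ j, ∀ᶠ n in atTop, (1 + 10 * (√(ω n))⁻¹) * (1 + M.A₂ / M.A₁ / ω n) *
      (1 + 8 / ω n) < (1 + ε) ^ (1 - M.exponent j) := by
    intro j
    have h1 : Tendsto (fun n => (1 + 10 * (√(ω n))⁻¹) * (1 + M.A₂ / M.A₁ / ω n) *
        (1 + 8 / ω n)) atTop (𝓝 ((1 + 10 * 0) * (1 + 0) * (1 + 0))) :=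
      (((hθ.const_mul 10).const_add 1).mul ((hω.const_div_atTop _).const_add 1)).mul
        ((hω.const_div_atTop _).const_add 1)
    -- The error factors tend to 1, which is strictly below `(1 + ε) ^ (1 - α)` because `α < 1`.
    refine h1.eventually_lt_const ?_
    have := Real.one_lt_rpow (by linarith : 1 < 1 + ε)
      (by linarith [M.exponent_lt_one j] : 0 < 1 - M.exponent j)
    linarith
  refine ⟨fun n => (18 + 2 * (M.A₂ / M.A₁)) * (√(ω n))⁻¹, ?_, ?_⟩
  · simpa using hθ.const_mul (18 + 2 * (M.A₂ / M.A₁))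
  have hlim : Tendsto (fun n : ℕ => 2 * (Fintype.card (Fin m → Fin M.K) : ℝ) / n) atTop (𝓝 0) :=
    tendsto_const_div_atTop_nhds_zero_nat _
  refine squeeze_zero' (Eventually.of_forall fun n => by positivity) ?_ hlim
  filter_upwards [eventually_all.2 hslack, eventually_ge_atTop 1,
    hω.eventually_ge_atTop (8 * (M.A₂ / M.A₁ + 2)),
    hθ.eventually_le_const (show (0 : ℝ) < 1 / 20 by norm_num),
    (Real.tendsto_log_atTop.comp tendsto_natCast_atTop_atTop).eventually_ge_atTop 1]
    with n hsl hn hw h20 hlog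
  have hA₁ := M.A₁_pos
  have hA₂ := M.A₂_pos
  have hw0 : 0 < ω n := lt_of_lt_of_le (by positivity) hw
  have hθ0 : 0 < (√(ω n))⁻¹ := by positivity
  have hθw : (√(ω n))⁻¹ ^ 2 * ω n = 1 := by
    rw [inv_pow, Real.sq_sqrt hw0.le, inv_mul_cancel₀ hw0.ne']
  have hn' : (0 : ℝ) < n := by exact_mod_cast hn
  have hsub : {ξ | ¬ M.DegreesPredicted ξ n (ω n) ε ((18 + 2 * (M.A₂ / M.A₁)) * (√(ω n))⁻¹)} ⊆
      {ξ | ¬ M.ExposBounded ξ n (√(ω n))⁻¹} := fun ξ hξ hgood =>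
    hξ (M.degreesPredicted_of_exposBounded hε hθ0 hθw (by linarith) hlog hw hsl hgood)
  calc (n : ℝ) * M.prob.real {ξ | ¬ M.DegreesPredicted ξ n (ω n) ε
        ((18 + 2 * (M.A₂ / M.A₁)) * (√(ω n))⁻¹)}
      ≤ n * (2 * Fintype.card (Fin m → Fin M.K) * ((n : ℝ) ^ 2)⁻¹) := by
        gcongr
        exact (measureReal_mono hsub).trans
          (M.prob_not_exposBounded_le hn hθ0.le (by linarith))
    _ = _ := by field_simp
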